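/- Let $T>0$ and let $\alpha:[0,T]\to(1/3,1)$ be continuous with $\sup\{|h|^{\alpha(t)-\alpha(t+h)} : t,t+h\in[0,T],\ |h|\le 1\}<\infty$. For $\beta:[0,T]\to(0,\infty)$ say that a function $g$ on $[0,T]^2$ with values in a finite-dimensional normed space has order $\beta(\cdot)$ if $$\sup\{\,|g_{t,t+h}|\,|h|^{-\beta(t)} : t,t+h\in[0,T],\ 0<|h|\le 1\}<\infty\quad\text{and}\quad g_{t,t}=0 \text{ for all } t;$$ a function $g$ on $[0,T]$ has order $\beta(\cdot)$ if its increments $g_{s,t}=g_t-g_s$ do. Let $\mathbf X=(X,\mathbb X)$ be a rough path of variable order $\alpha(\cdot)$: $X:[0,T]\to\mathbb R^d$ has order $\alpha(\cdot)$, $\mathbb X:[0,T]^2\to\mathbb R^{d\times d}$ has order $2\alpha(\cdot)\wedge1$, and $\mathbb X_{s,t}-\mathbb X_{s,u}-\mathbb X_{u,t}=X_{s,u}\otimes X_{u,t}$ for $0\le s\le u\le t\le T$. Let $f:\mathbb R^n\to L(\mathbb R^d,\mathbb R^n)\cong\mathbb R^{d\times n}$ be of class $C_b^3$ (three times continuously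 differentiable, bounded together with its derivatives up to order three) and let $y\in\mathbb R^n$. Let $\mathcal D_X^{\alpha(\cdot)}$ be the space of variable-order controlled paths, that is, of pairs $(Y,Y')$ with $Y:[0,T]\to\mathbb R^n$, $Y':[0,T]\to L(\mathbb R^d,\mathbb R^n)$, such that $Y'$ has order $\alpha(\cdot)$ and the remainder $R^Y_{s,t}=Y_{s,t}-Y'_sX_{s,t}$ has order $2\alpha(\cdot)\wedge 1$. Then there is a unique $(Y,Y')\in\mathcal D_X^{\alpha(\cdot)}$ that solves $dY_t=f(Y_t)\,d\mathbf X_t$, $Y_0=y$, i.e. such that $Y_0=y$ and, for all $t\in[0,T]$, $$Y'_t=f(Y_t),\qquad Y_t=y+\int_0^t f(Y_r)\,d\mathbf X_r:=y+\lim_{|\mathcal P|\to0}\sum_{[u,v]\in\mathcal P}\Big(f(Y_u)X_{u,v}+Df(Y_u)Y'_u\,\mathbb X_{u,v}\Big),$$ the limit being over partitions $\mathcal P$ of $[0,t]$ whose mesh $|\mathcal P|$ tends to $0$ (and existing for this $(Y,Y')$). If moreover $\mathbb X$ has order $2\alpha(\cdot)$ (for instance if $\alpha\le 1/2$), then $R^Y$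 has order $2\alpha(\cdot)$. -/

import Mathlib

noncomputable section

namespace VariableOrder

/-- The state space `ℝⁿ` with its Euclidean norm. -/
abbrev Vec (n : ℕ) : Type := EuclideanSpace ℝ (Fin n)

/-- The space `ℝ^{d×d}` of second order objects, with the Euclidean (Frobenius) norm;
the entry in row `i` and column `j` of `A` is `A (i, j)`. -/
abbrev SqMat (d : ℕ) : Type := EuclideanSpace ℝ (Fin d × Fin d)

/-- `ℝ^{d×n}`, read as linear maps `ℝ^d → ℝ^n`, with the operator norm. -/
abbrev LinVec (d n : ℕ) : Type := Vec d →L[ℝ] Vec n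

/-- Admissible regularity functions on `[0,T]`: continuous, with
`sup_{t, |h| ≤ 1} |h|^{α(t) - α(t+h)} < ∞` (here `s = t + h`). -/
def IsRegularityFunction (T : ℝ) (α : ℝ → ℝ) : Prop :=
  ContinuousOn α (Set.Icc 0 T) ∧
  ∃ C : ℝ, ∀ t ∈ Set.Icc 0 T, ∀ s ∈ Set.Icc 0 T, |s - t| ≤ 1 →
    |s - t| ^ (α t - α s) ≤ C

/-- The two-parameter space `C₂^{β(·)}([0,T]²; E)`: the seminorm
`sup_{t, |h| ≤ 1} |g(t,t+h)| / |h|^{β(t)}` is finite. -/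
def IsHolderTwo {E : Type*} [NormedAddCommGroup E] (T : ℝ) (β : ℝ → ℝ) (g : ℝ → ℝ → E) : Prop :=
  ∃ C : ℝ, ∀ s ∈ Set.Icc 0 T, ∀ t ∈ Set.Icc 0 T, |t - s| ≤ 1 →
    ‖g s t‖ ≤ C * |t - s| ^ (β s)

/-- The Hölder space `C^{β(·)}([0,T]; E)` of variable order `β`. -/
def IsHolder {E : Type*} [NormedAddCommGroup E] (T : ℝ) (β : ℝ → ℝ) (g : ℝ → E) : Prop :=
  IsHolderTwo T β (fun s t => g t - g s)

/-- `(X, 𝕏)` is a rough path of variable order `α` on `[0,T]` with values in `ℝ^d`: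
`X` has order `α(·)`, `𝕏` has order `2α(·) ∧ 1`, and Chen's relation
`𝕏_{s,t} - 𝕏_{s,u} - 𝕏_{u,t} = X_{s,u} ⊗ X_{u,t}` holds. -/
structure IsRoughPath {d : ℕ} (T : ℝ) (α : ℝ → ℝ) (X : ℝ → Vec d) (XX : ℝ → ℝ → SqMat d) :
    Prop where
  holder_fst : IsHolder T α X
  holder_snd : IsHolderTwo T (fun s => min (2 * α s) 1) XX
  chen : ∀ s ∈ Set.Icc 0 T, ∀ u ∈ Set.Icc 0 T, ∀ t ∈ Set.Icc 0 T, s ≤ u → u ≤ t →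
    ∀ i j : Fin d, (XX s t - XX s u - XX u t) (i, j) = (X u - X s) i * (X t - X u) j

/-- The remainder `R^Y_{s,t} = Y_{s,t} - Y'_s X_{s,t}`. -/
def remainder {d n : ℕ} (X : ℝ → Vec d) (Y : ℝ → Vec n) (Y' : ℝ → LinVec d n) (s t : ℝ) : Vec n :=
  (Y t - Y s) - Y' s (X t - X s)

/-- `(Y, Y')` is a controlled path of variable order `α` with respect to `X`:
`Y'` has order `α(·)` and the remainder has order `2α(·) ∧ 1`. -/
structure IsControlled {d n : ℕ} (T : ℝ) (α : ℝ → ℝ) (X : ℝ → Vec d)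
    (Y : ℝ → Vec n) (Y' : ℝ → LinVec d n) : Prop where
  holder_deriv : IsHolder T α Y'
  holder_remainder : IsHolderTwo T (fun s => min (2 * α s) 1) (remainder X Y Y')

/-- The action of `L ∈ L(ℝ^d, L(ℝ^d, ℝ^n))` on `A ∈ ℝ^{d×d} ≅ ℝ^d ⊗ ℝ^d`. -/
def tensorApply {d n : ℕ} (L : Vec d →L[ℝ] LinVec d n) (A : SqMat d) : Vec n :=
  ∑ i : Fin d, ∑ j : Fin d,
    A (i, j) • L (EuclideanSpace.single i (1 : ℝ)) (EuclideanSpace.single j (1 : ℝ))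

/-- The germ `Ξ_{s,t} = Z_s X_{s,t} + Z'_s 𝕏_{s,t}` of the rough integral of `(Z, Z')`. -/
def germ {d n : ℕ} (X : ℝ → Vec d) (XX : ℝ → ℝ → SqMat d)
    (Z : ℝ → LinVec d n) (Z' : ℝ → Vec d →L[ℝ] LinVec d n) (s t : ℝ) : Vec n :=
  Z s (X t - X s) + tensorApply (Z' s) (XX s t)

/-- `I = lim_{|P| → 0} ∑_{[u,v] ∈ P} Ξ_{u,v}` over the partitions
`P : a = p 0 ≤ p 1 ≤ … ≤ p N = b` of `[a,b]`. -/
def IsRiemannLimit {E : Type*} [NormedAddCommGroup E] (Ξ : ℝ → ℝ → E) (a b : ℝ) (I : E) : Prop :=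
  ∀ ε > 0, ∃ δ > 0, ∀ (N : ℕ) (p : ℕ → ℝ), Monotone p → p 0 = a → p N = b →
    (∀ i < N, p (i + 1) - p i < δ) →
    ‖(∑ i ∈ Finset.range N, Ξ (p i) (p (i + 1))) - I‖ < ε

/-- `I = ∫_a^b Z_r d𝐗_r`, the rough integral of the controlled path `(Z, Z')`. -/
def IsRoughIntegral {d n : ℕ} (X : ℝ → Vec d) (XX : ℝ → ℝ → SqMat d)
    (Z : ℝ → LinVec d n) (Z' : ℝ → Vec d →L[ℝ] LinVec d n) (a b : ℝ) (I : Vec n) : Prop :=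
  IsRiemannLimit (germ X XX Z Z') a b I

/-- The class `C_b^k`: `k` times continuously differentiable, bounded together with all
derivatives up to order `k`. -/
def IsCb {E F : Type*} [NormedAddCommGroup E] [NormedSpace ℝ E] [NormedAddCommGroup F]
    [NormedSpace ℝ F] (k : ℕ) (f : E → F) : Prop :=
  ContDiff ℝ k f ∧ ∃ M : ℝ, ∀ j ≤ k, ∀ x : E, ‖iteratedFDeriv ℝ j f x‖ ≤ M

/-- `(Y, Y')` solves `dY = f(Y) d𝐗`, `Y_0 = y` on `[0,T]`: it is a controlled path with
`Y' = f(Y)` and `Y_t = y + ∫_0^t f(Y_r) d𝐗_r`, where the integrand is the controlled path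
`(f(Y), f'(Y) Y')`. -/
structure IsRDESolution {d n : ℕ} (T : ℝ) (α : ℝ → ℝ) (X : ℝ → Vec d) (XX : ℝ → ℝ → SqMat d)
    (f : Vec n → LinVec d n) (y : Vec n) (Y : ℝ → Vec n) (Y' : ℝ → LinVec d n) : Prop where
  controlled : IsControlled T α X Y Y'
  initial : Y 0 = y
  deriv_eq : ∀ t ∈ Set.Icc 0 T, Y' t = f (Y t)
  integral_eq : ∀ t ∈ Set.Icc 0 T,
    IsRoughIntegral X XX (fun r => f (Y r)) (fun r => (fderiv ℝ f (Y r)).comp (Y' r)) 0 t (Y t - y)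

end VariableOrder

end

noncomputable section

namespace VariableOrder

open Filter Topology

/-! ### Sewing estimates -/

/-! The equation is solved through its second-order scheme `y ↦ y + rdeIncr f X XX s t y`, whose
increment is `f(y) X_{s,t} + Df(y) f(y) 𝕏_{s,t}`. Choose a constant order `a` with `1/3 < a ≤ 1/2`
below `α`. By Chen's relation and Taylor's formula, composing the scheme over `[s,u]` and `[u,t]`
differs from the scheme over `[s,t]` by `O((t-s)^(3a))`, also in the Lipschitz sense in the initial
value. Since `3a > 1`, this is an almost flow (`RoughBound.exists_almostFlow`).

Everything abstract is then a sewing argument. Euler schemes stay within `O((t-s)^(3a))` of one step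
of the scheme, uniformly in the mesh (`AlmostFlow.euler_bound`), and a pointwise limit point of them
is a path that follows the almost flow (`AlmostFlow.exists_follows`). Two such paths with the same
start agree, because the difference of their local errors is controlled by their distance times a
superlinear factor (`AlmostFlow.unique`).

Following the almost flow is equivalent to solving the equation. If the local errors are
`O((t-s)^θ)` with `θ > 1`, they sum to zero in the limit, which gives the integral; they are also
negligible against order `2α ∧ 1`, so the variable orders of `Y` and its remainder are those of `X`
and `𝕏` (`Follows.isRDESolution`). Conversely, the local error of a solution has a superlinear
defect and vanishing Riemann sums, hence is superlinear (`sewing_bound`, `norm_error_le`,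
`IsRDESolution.exists_follows`).

For the remainder of order `2α`, which may exceed `1`, the sewing estimate is repeated on short
intervals with the local order `α(s) - η`; its error then has order at least `2α(s)`. -/

lemma rpow_le_mul_of_le {r c θ : ℝ} (hr : 0 ≤ r) (hrc : r ≤ c) (hθ : 1 < θ) :
    r ^ θ ≤ c ^ (θ - 1) * r := by
  rcases hr.eq_or_lt with rfl | hr'
  · rw [Real.zero_rpow (by linarith)]; simp
  · calc r ^ θ = r ^ (θ - 1) * r := by
          rw [← Real.rpow_add_one hr'.ne', sub_add_cancel]
      _ ≤ c ^ (θ - 1) * r := by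
          gcongr

/-- A discrete sewing lemma: a quantity that vanishes on single steps and is almost
subadditive up to a superlinear error is superlinear. -/
lemma discrete_sewing {e : ℕ → ℕ → ℝ} {P : ℕ → ℕ → Prop} {θ τ A κ C : ℝ}
    (hP : ∀ i k j, i ≤ k → k ≤ j → P i j → P i k ∧ P k j)
    (hθ : 1 < θ) (hτ : 0 ≤ τ) (hA : 1 ≤ A) (hC : 0 ≤ C)
    (hκ : A * (2 / 3 : ℝ) ^ (θ - 1) ≤ κ) (hκ1 : κ < 1)
    (h0 : ∀ i, P i i → e i i ≤ 0) (h1 : ∀ i, P i (i + 1) → e i (i + 1) ≤ 0)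
    (hstep : ∀ i k j, i < k → k < j → P i j →
      e i j ≤ A * e i k + e k j + C * (((j : ℝ) - i) * τ) ^ θ) :
    ∀ m i, P i (i + m) → e i (i + m) ≤ C / (1 - κ) * ((m : ℝ) * τ) ^ θ := by
  have hK : 0 ≤ C / (1 - κ) := div_nonneg hC (by linarith)
  intro m
  induction m using Nat.strong_induction_on with
  | _ m ih =>
    intro i hi
    rcases Nat.lt_or_ge m 2 with hm | hm
    · have h : e i (i + m) ≤ 0 := by
        interval_cases m
        · exact h0 i hi
        · exact h1 i hi
      exact h.trans (by positivity)
    -- Odd lengths cannot be halved exactly; for `m ≥ 2` both parts of the near-halving have length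
    -- at most `2m/3`, whence the ratio `2/3`.
    · obtain ⟨k, l, hkl, hk1, hl1, hk, hl⟩ : ∃ k l : ℕ, k + l = m ∧ 1 ≤ k ∧ 1 ≤ l ∧
          3 * k ≤ 2 * m ∧ 3 * l ≤ 2 * m := ⟨m / 2, m - m / 2, by omega, by omega, by omega,
            by omega, by omega⟩
      have hm0 : (0 : ℝ) < m := by exact_mod_cast (by omega : 0 < m)
      have hsplit := hP i (i + k) (i + m) (by omega) (by omega) hi
      have e1 := ih k (by omega) i hsplit.1
      have e2 := ih l (by omega) (i + k) (by
        rw [show i + k + l = i + m by omega]; exact hsplit.2)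
      rw [show i + k + l = i + m by omega] at e2
      have e3 := hstep i (i + k) (i + m) (by omega) (by omega) hi
      -- One factor `q / m` is kept linear, so that the contributions of the two parts add up
      -- through `k/m + l/m = 1`; the other `θ - 1` powers supply the contraction.
      have key : ∀ q : ℕ, 3 * q ≤ 2 * m → ((q : ℝ) * τ) ^ θ ≤
          (2 / 3 : ℝ) ^ (θ - 1) * (q / m) * ((m : ℝ) * τ) ^ θ := by
        intro q hq
        have hq' : (3 : ℝ) * q ≤ 2 * m := by exact_mod_cast hq
        have : (q : ℝ) * τ = (q / m) * (m * τ) := by field_simp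
        rw [this, Real.mul_rpow (by positivity) (by positivity)]
        gcongr
        apply rpow_le_mul_of_le (by positivity) _ hθ
        rw [div_le_div_iff₀ hm0 (by norm_num)]; linarith
      have k1 := key k hk
      have k2 := key l hl
      have hsum : (k : ℝ) / m + l / m = 1 := by
        rw [← add_div, div_eq_one_iff_eq hm0.ne']; exact_mod_cast hkl
      set W := ((m : ℝ) * τ) ^ θ with hW
      have hW0 : 0 ≤ W := by positivity
      set ρ := (2 / 3 : ℝ) ^ (θ - 1) with hρ
      have hρ0 : 0 ≤ ρ := by positivity
      set K := C / (1 - κ) with hKdef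
      -- `K` is the fixed point of `K ↦ κ K + C`, so the induction reproduces the constant.
      have hKC : κ * K + C = K := by
        rw [hKdef]; field_simp [show (1 - κ) ≠ 0 by linarith]; ring
      have hcast : (((i + m : ℕ) : ℝ) - i) = m := by push_cast; ring
      rw [hcast] at e3
      calc e i (i + m) ≤ A * (K * (ρ * (k / m) * W)) + A * (K * (ρ * (l / m) * W)) + C * W := by
            have a1 : A * e i (i + k) ≤ A * (K * (ρ * (k / m) * W)) := by
              gcongr; exact e1.trans (by gcongr)
            have a2 : e (i + k) (i + m) ≤ A * (K * (ρ * (l / m) * W)) := by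
              have : 0 ≤ K * (ρ * (l / m) * W) := by positivity
              calc _ ≤ K * (ρ * (l / m) * W) := e2.trans (by gcongr)
                _ ≤ _ := le_mul_of_one_le_left this hA
            linarith
        _ = (A * ρ * K + C) * W := by
            linear_combination A * K * ρ * W * hsum
        _ ≤ (κ * K + C) * W := by gcongr
        _ = K * W := by rw [hKC]

/-- A finite a priori constant improves itself: iterating `N ↦ κ N + b` converges to the fixed point
`b / (1 - κ)`, whatever the initial `N`. -/
lemma le_of_contraction {ι : Type*} {S : Set ι} {u w : ι → ℝ} {κ b N : ℝ}
    (hκ0 : 0 ≤ κ) (hκ1 : κ < 1)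
    (hN : ∀ i ∈ S, u i ≤ N * w i)
    (step : ∀ N, (∀ i ∈ S, u i ≤ N * w i) → ∀ i ∈ S, u i ≤ (κ * N + b) * w i) :
    ∀ i ∈ S, u i ≤ b / (1 - κ) * w i := by
  have h : ∀ k : ℕ, ∀ i ∈ S, u i ≤ (κ ^ k * (N - b / (1 - κ)) + b / (1 - κ)) * w i := by
    intro k
    induction k with
    | zero => simpa using hN
    | succ k ih =>
      intro i hi
      refine (step _ ih i hi).trans_eq ?_
      congr 1
      field_simp [show (1 - κ) ≠ 0 by linarith]
      ring
  intro i hi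
  refine ge_of_tendsto' (x := atTop) (f := fun k : ℕ => (κ ^ k * (N - b / (1 - κ)) + b / (1 - κ)) * w i) ?_
    (fun k => h k i hi)
  have := (((tendsto_pow_atTop_nhds_zero_of_lt_one hκ0 hκ1).mul_const
    (N - b / (1 - κ))).add_const (b / (1 - κ))).mul_const (w i)
  simpa using this

/-- The uniform partition sums of a two-parameter function. -/
def uniformSum {E : Type*} [AddCommMonoid E] (Ξ : ℝ → ℝ → E) (a b : ℝ) (N : ℕ) : E :=
  ∑ i ∈ Finset.range N, Ξ (a + i * ((b - a) / N)) (a + (i + 1 : ℕ) * ((b - a) / N))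

lemma two_thirds_rpow_lt_one {θ : ℝ} (hθ : 1 < θ) : (2 / 3 : ℝ) ^ (θ - 1) < 1 :=
  Real.rpow_lt_one (by norm_num) (by norm_num) (by linarith)

lemma two_thirds_rpow_anti {θ₀ θ : ℝ} (hθ : θ₀ ≤ θ) :
    (2 / 3 : ℝ) ^ (θ - 1) ≤ (2 / 3 : ℝ) ^ (θ₀ - 1) :=
  Real.rpow_le_rpow_of_exponent_ge (by norm_num) (by norm_num) (by linarith)

/-- A germ with superlinear defect whose partition sums vanish in the limit is superlinear. -/
lemma sewing_bound {E : Type*} [NormedAddCommGroup E] {Ξ : ℝ → ℝ → E} {a b C θ₀ θ : ℝ}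
    (hab : a ≤ b) (hC : 0 ≤ C) (hθ₀ : 1 < θ₀) (hθ : θ₀ ≤ θ)
    (hδ : ∀ s u t, a ≤ s → s ≤ u → u ≤ t → t ≤ b → ‖Ξ s t - Ξ s u - Ξ u t‖ ≤ C * (t - s) ^ θ)
    (hlim : Tendsto (uniformSum Ξ a b) atTop (𝓝 0)) :
    ‖Ξ a b‖ ≤ C / (1 - (2 / 3 : ℝ) ^ (θ₀ - 1)) * (b - a) ^ θ := by
  have hθ1 : 1 < θ := hθ₀.trans_le hθ
  have hbound : ∀ N : ℕ, 1 ≤ N → ‖Ξ a b - uniformSum Ξ a b N‖ ≤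
      C / (1 - (2 / 3 : ℝ) ^ (θ₀ - 1)) * (b - a) ^ θ := by
    intro N hN
    have hN0 : (0 : ℝ) < N := by exact_mod_cast hN
    set τ := (b - a) / N with hτ
    have hτ0 : 0 ≤ τ := div_nonneg (by linarith) hN0.le
    have hNτ : N * τ = b - a := by rw [hτ]; field_simp
    set p : ℕ → ℝ := fun i => a + i * τ with hp
    have hpm : ∀ i j : ℕ, i ≤ j → p i ≤ p j := by
      intro i j hij
      have : (i : ℝ) ≤ j := by exact_mod_cast hij
      simp only [hp]; gcongr
    have hpa : ∀ i, a ≤ p i := fun i => by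
      have : 0 ≤ i * τ := by positivity
      simp only [hp]; linarith
    have hpb : ∀ i ≤ N, p i ≤ b := fun i hi => by
      refine (hpm i N hi).trans_eq ?_
      simp only [hp]; linarith
    -- The ratio is taken at `θ₀` and not at `θ`, so that the constant is uniform in `θ ≥ θ₀`; this
    -- is needed when `θ` follows a variable order.
    have := discrete_sewing
      (e := fun i j => ‖Ξ (p i) (p j) - ∑ l ∈ Finset.Ico i j, Ξ (p l) (p (l + 1))‖)
      (P := fun _ j => j ≤ N) (θ := θ) (τ := τ) (A := 1) (C := C)
      (κ := (2 / 3 : ℝ) ^ (θ₀ - 1))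
      (fun i k j _ hkj hj => ⟨hkj.trans hj, hj⟩) hθ1 hτ0 le_rfl hC
      (by rw [one_mul]; exact two_thirds_rpow_anti hθ) (two_thirds_rpow_lt_one hθ₀)
      -- The defect of the degenerate triple `s = u = t` is `-Ξ s s`, so the hypothesis on the
      -- defect forces `Ξ` to vanish on the diagonal.
      (fun i hi => by
        have h := hδ (p i) (p i) (p i) (hpa i) le_rfl le_rfl (hpb i hi)
        simp only [sub_self, zero_sub, norm_neg] at h
        rw [Real.zero_rpow (by linarith), mul_zero] at h
        simpa using h)
      (fun i _ => by simp)
      (fun i k j hik hkj hj => by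
        have h := hδ (p i) (p k) (p j) (hpa i) (hpm _ _ hik.le) (hpm _ _ hkj.le) (hpb j hj)
        have h2 : p j - p i = ((j : ℝ) - i) * τ := by simp only [hp]; ring
        rw [h2] at h
        rw [← Finset.sum_Ico_consecutive _ hik.le hkj.le]
        set S1 := ∑ l ∈ Finset.Ico i k, Ξ (p l) (p (l + 1))
        set S2 := ∑ l ∈ Finset.Ico k j, Ξ (p l) (p (l + 1))
        have : Ξ (p i) (p j) - (S1 + S2) = (Ξ (p i) (p k) - S1) + (Ξ (p k) (p j) - S2) +
          (Ξ (p i) (p j) - Ξ (p i) (p k) - Ξ (p k) (p j)) := by abel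
        rw [this, one_mul]
        exact (norm_add₃_le).trans (by gcongr)) N 0 (by simp)
    simp only [zero_add, Nat.Ico_zero_eq_range] at this
    rw [hNτ] at this
    have h0 : p 0 = a := by simp [hp]
    have h1 : p N = b := by simp only [hp]; linarith
    rw [h0, h1] at this
    exact this
  have hl : Tendsto (fun N => ‖Ξ a b - uniformSum Ξ a b N‖) atTop (𝓝 ‖Ξ a b‖) := by
    simpa using (hlim.const_sub (Ξ a b)).norm
  exact le_of_tendsto hl (eventually_atTop.2 ⟨1, hbound⟩)

/-! ### Vector fields with bounded derivatives -/

section LipIncr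

variable {E F G H : Type*} [NormedAddCommGroup E] [NormedAddCommGroup F]

/-- Bounded Lipschitz functions whose increments are Lipschitz in the base point. -/
structure HasLipIncr (M : ℝ) (F₀ : E → F) : Prop where
  bound : ∀ y, ‖F₀ y‖ ≤ M
  lip : ∀ y z, ‖F₀ y - F₀ z‖ ≤ M * ‖y - z‖
  incr : ∀ y z w, ‖F₀ (y + w) - F₀ y - (F₀ (z + w) - F₀ z)‖ ≤ M * ‖w‖ * ‖y - z‖

lemma HasLipIncr.nonneg {M : ℝ} {F₀ : E → F} (h : HasLipIncr M F₀) : 0 ≤ M :=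
  (norm_nonneg _).trans (h.bound 0)

lemma HasLipIncr.mono {M M' : ℝ} {F₀ : E → F} (h : HasLipIncr M F₀) (hM : M ≤ M') :
    HasLipIncr M' F₀ :=
  ⟨fun y => (h.bound y).trans hM, fun y z => (h.lip y z).trans (by gcongr),
    fun y z w => (h.incr y z w).trans (by gcongr)⟩

variable [NormedSpace ℝ F] [NormedAddCommGroup G] [NormedSpace ℝ G]
  [NormedAddCommGroup H] [NormedSpace ℝ H]

/-- The discrete product rule for second differences has four terms, each at most `c * M * M * ‖w‖ *
‖y - z‖`; this is the origin of the factor `4`. -/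
lemma HasLipIncr.bilin {M c : ℝ} {F₀ : E → F} {G₀ : E → G} (B : F →ₗ[ℝ] G →ₗ[ℝ] H)
    (hB : ∀ u v, ‖B u v‖ ≤ c * ‖u‖ * ‖v‖) (hc : 0 ≤ c)
    (hF : HasLipIncr M F₀) (hG : HasLipIncr M G₀) :
    HasLipIncr (4 * c * M * M) (fun y => B (F₀ y) (G₀ y)) := by
  have hM := hF.nonneg
  have hM2 : 0 ≤ c * M * M := by positivity
  refine ⟨fun y => ?_, fun y z => ?_, fun y z w => ?_⟩
  · calc _ ≤ c * ‖F₀ y‖ * ‖G₀ y‖ := hB _ _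
      _ ≤ c * M * M := by gcongr; exacts [hF.bound y, hG.bound y]
      _ ≤ _ := by linarith
  · have : B (F₀ y) (G₀ y) - B (F₀ z) (G₀ z) =
        B (F₀ y - F₀ z) (G₀ y) + B (F₀ z) (G₀ y - G₀ z) := by simp
    rw [this]
    calc _ ≤ c * ‖F₀ y - F₀ z‖ * ‖G₀ y‖ + c * ‖F₀ z‖ * ‖G₀ y - G₀ z‖ :=
          (norm_add_le _ _).trans (add_le_add (hB _ _) (hB _ _))
      _ ≤ c * (M * ‖y - z‖) * M + c * M * (M * ‖y - z‖) := by
          gcongr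
          exacts [hF.lip y z, hG.bound y, hF.bound z, hG.lip y z]
      _ ≤ _ := by nlinarith [mul_nonneg hM2 (norm_nonneg (y - z))]
  · have : B (F₀ (y + w)) (G₀ (y + w)) - B (F₀ y) (G₀ y) -
        (B (F₀ (z + w)) (G₀ (z + w)) - B (F₀ z) (G₀ z)) =
        B (F₀ (y + w) - F₀ y - (F₀ (z + w) - F₀ z)) (G₀ (y + w)) +
        B (F₀ (z + w) - F₀ z) (G₀ (y + w) - G₀ (z + w)) +
        (B (F₀ y) (G₀ (y + w) - G₀ y - (G₀ (z + w) - G₀ z)) +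
        B (F₀ y - F₀ z) (G₀ (z + w) - G₀ z)) := by
      simp only [map_sub, LinearMap.sub_apply]; abel
    rw [this]
    have l1 : ‖F₀ (z + w) - F₀ z‖ ≤ M * ‖w‖ := by simpa using hF.lip (z + w) z
    have l2 : ‖G₀ (z + w) - G₀ z‖ ≤ M * ‖w‖ := by simpa using hG.lip (z + w) z
    have l3 : ‖G₀ (y + w) - G₀ (z + w)‖ ≤ M * ‖y - z‖ := by simpa using hG.lip (y + w) (z + w)
    calc _ ≤ c * ‖F₀ (y + w) - F₀ y - (F₀ (z + w) - F₀ z)‖ * ‖G₀ (y + w)‖ +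
          c * ‖F₀ (z + w) - F₀ z‖ * ‖G₀ (y + w) - G₀ (z + w)‖ +
          (c * ‖F₀ y‖ * ‖G₀ (y + w) - G₀ y - (G₀ (z + w) - G₀ z)‖ +
          c * ‖F₀ y - F₀ z‖ * ‖G₀ (z + w) - G₀ z‖) :=
          (norm_add_le _ _).trans (add_le_add
            ((norm_add_le _ _).trans (add_le_add (hB _ _) (hB _ _)))
            ((norm_add_le _ _).trans (add_le_add (hB _ _) (hB _ _))))
      _ ≤ c * (M * ‖w‖ * ‖y - z‖) * M + c * (M * ‖w‖) * (M * ‖y - z‖) +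
          (c * M * (M * ‖w‖ * ‖y - z‖) + c * (M * ‖y - z‖) * (M * ‖w‖)) := by
          gcongr
          exacts [hF.incr y z w, hG.bound _, hF.bound y, hG.incr y z w, hF.lip y z]
      _ = _ := by ring

end LipIncr

section Calculus

variable {E F : Type*} [NormedAddCommGroup E] [NormedSpace ℝ E]
  [NormedAddCommGroup F] [NormedSpace ℝ F]

/-- The first order Taylor remainder. -/
def taylorRem (F₀ : E → F) (y w : E) : F := F₀ (y + w) - F₀ y - fderiv ℝ F₀ y w

/-- The derivative of `w ↦ taylorRem F₀ z w` is `DF₀(z + w) - DF₀(z)`, of norm at most `M ‖w‖`; the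
mean value inequality is applied on the ball about `0` containing both points. -/
lemma norm_taylorRem_sub_le_right {F₀ : E → F} {M : ℝ} (hd : Differentiable ℝ F₀)
    (hl : ∀ y z, ‖fderiv ℝ F₀ y - fderiv ℝ F₀ z‖ ≤ M * ‖y - z‖) (hM : 0 ≤ M) (z w w' : E) :
    ‖taylorRem F₀ z w - taylorRem F₀ z w'‖ ≤ M * max ‖w‖ ‖w'‖ * ‖w - w'‖ := by
  refine (convex_closedBall (0 : E) (max ‖w‖ ‖w'‖)).norm_image_sub_le_of_norm_hasFDerivWithin_le
    (f := taylorRem F₀ z) (f' := fun v => fderiv ℝ F₀ (z + v) - fderiv ℝ F₀ z) ?_ ?_ ?_ ?_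
  · intro v _
    apply HasFDerivAt.hasFDerivWithinAt
    have h1 : HasFDerivAt (fun v => F₀ (z + v)) (fderiv ℝ F₀ (z + v)) v := by
      have := (hd (z + v)).hasFDerivAt
      simpa [Function.comp_def] using this.comp v ((hasFDerivAt_id v).const_add z)
    exact (h1.sub_const (F₀ z)).sub (fderiv ℝ F₀ z).hasFDerivAt
  · intro v hv
    refine (hl _ _).trans ?_
    have : ‖v‖ ≤ max ‖w‖ ‖w'‖ := by simpa using hv
    rw [add_sub_cancel_left]; gcongr
  · simp
  · simp

lemma norm_taylorRem_le {F₀ : E → F} {M : ℝ} (hd : Differentiable ℝ F₀)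
    (hl : ∀ y z, ‖fderiv ℝ F₀ y - fderiv ℝ F₀ z‖ ≤ M * ‖y - z‖) (hM : 0 ≤ M) (z w : E) :
    ‖taylorRem F₀ z w‖ ≤ M * ‖w‖ ^ 2 := by
  have := norm_taylorRem_sub_le_right hd hl hM z w 0
  simpa [taylorRem, pow_two, mul_assoc] using this

/-- Differentiating the Taylor remainder of `F₀` in the base point gives the Taylor remainder of
`DF₀`, which is quadratic in `w`. This costs a third derivative of `F₀`. -/
lemma norm_taylorRem_sub_le_left {F₀ : E → F} {M : ℝ} (hF : ContDiff ℝ 2 F₀)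
    (hl : ∀ y z, ‖fderiv ℝ (fderiv ℝ F₀) y - fderiv ℝ (fderiv ℝ F₀) z‖ ≤ M * ‖y - z‖)
    (hM : 0 ≤ M) (y z w : E) :
    ‖taylorRem F₀ y w - taylorRem F₀ z w‖ ≤ M * ‖w‖ ^ 2 * ‖y - z‖ := by
  have hd : Differentiable ℝ F₀ := hF.differentiable (by norm_num)
  have hd' : Differentiable ℝ (fderiv ℝ F₀) :=
    (hF.fderiv_right (m := 1) (by norm_num)).differentiable (by norm_num)
  refine (convex_univ (𝕜 := ℝ)).norm_image_sub_le_of_norm_hasFDerivWithin_le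
    (f := fun y => taylorRem F₀ y w) (f' := fun v => taylorRem (fderiv ℝ F₀) v w) ?_ ?_
    (Set.mem_univ _) (Set.mem_univ _)
  · intro v _
    apply HasFDerivAt.hasFDerivWithinAt
    have h1 : HasFDerivAt (fun v => F₀ (v + w)) (fderiv ℝ F₀ (v + w)) v := by
      have := (hd (v + w)).hasFDerivAt
      simpa [Function.comp_def] using this.comp v ((hasFDerivAt_id v).add_const w)
    have h2 : HasFDerivAt (fun v => fderiv ℝ F₀ v w) ((fderiv ℝ (fderiv ℝ F₀) v).flip w) v := by
      have := (hd' v).hasFDerivAt.clm_apply (hasFDerivAt_const w v)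
      simpa using this
    -- Differentiating `v ↦ DF₀(v) w` puts the new direction in the first slot; symmetry of the
    -- second derivative moves `w` there, as in the Taylor remainder of `DF₀`.
    have h3 : (fderiv ℝ (fderiv ℝ F₀) v).flip w = fderiv ℝ (fderiv ℝ F₀) v w := by
      ext u
      exact (hF.contDiffAt.isSymmSndFDerivAt (by simp)) u w
    rw [h3] at h2
    exact (h1.sub (hd v).hasFDerivAt).sub h2
  · intro v _
    exact norm_taylorRem_le hd' hl hM v w

lemma norm_sub_le_of_norm_fderiv_le {F₀ : E → F} {M : ℝ} (hd : Differentiable ℝ F₀)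
    (h1 : ∀ y, ‖fderiv ℝ F₀ y‖ ≤ M) (y z : E) : ‖F₀ y - F₀ z‖ ≤ M * ‖y - z‖ :=
  convex_univ.norm_image_sub_le_of_norm_fderiv_le (𝕜 := ℝ) (fun x _ => hd x) (fun x _ => h1 x)
    (Set.mem_univ _) (Set.mem_univ _)

/-- The second difference is a first difference of `v ↦ F₀ (v + w) - F₀ v`, whose derivative is at
most `M ‖w‖`. -/
lemma HasLipIncr.of_fderiv {M : ℝ} {F₀ : E → F} (hd : Differentiable ℝ F₀)
    (h0 : ∀ y, ‖F₀ y‖ ≤ M) (h1 : ∀ y, ‖fderiv ℝ F₀ y‖ ≤ M)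
    (h2 : ∀ y z, ‖fderiv ℝ F₀ y - fderiv ℝ F₀ z‖ ≤ M * ‖y - z‖) : HasLipIncr M F₀ := by
  refine ⟨h0, norm_sub_le_of_norm_fderiv_le hd h1, fun y z w => ?_⟩
  refine (convex_univ (𝕜 := ℝ)).norm_image_sub_le_of_norm_hasFDerivWithin_le
    (f := fun v => F₀ (v + w) - F₀ v) (f' := fun v => fderiv ℝ F₀ (v + w) - fderiv ℝ F₀ v) ?_ ?_
    (Set.mem_univ _) (Set.mem_univ _)
  · intro v _
    apply HasFDerivAt.hasFDerivWithinAt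
    have h1 : HasFDerivAt (fun v => F₀ (v + w)) (fderiv ℝ F₀ (v + w)) v := by
      have := (hd (v + w)).hasFDerivAt
      simpa [Function.comp_def] using this.comp v ((hasFDerivAt_id v).add_const w)
    exact h1.sub (hd v).hasFDerivAt
  · intro v _
    simpa using h2 (v + w) v

lemma norm_fderiv_le_of_iteratedFDeriv {F₀ : E → F} {M : ℝ}
    (h : ∀ y, ‖iteratedFDeriv ℝ 1 F₀ y‖ ≤ M) (y : E) : ‖fderiv ℝ F₀ y‖ ≤ M := by
  rw [← norm_iteratedFDeriv_one]; exact h y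

lemma norm_fderiv_sub_le_of_iteratedFDeriv {F₀ : E → F} {M : ℝ} (hc : ContDiff ℝ 2 F₀)
    (h : ∀ y, ‖iteratedFDeriv ℝ 2 F₀ y‖ ≤ M) (y z : E) :
    ‖fderiv ℝ F₀ y - fderiv ℝ F₀ z‖ ≤ M * ‖y - z‖ :=
  norm_sub_le_of_norm_fderiv_le
    ((hc.fderiv_right (m := 1) (by norm_num)).differentiable (by norm_num))
    (norm_fderiv_le_of_iteratedFDeriv fun y => by rw [norm_iteratedFDeriv_fderiv]; exact h y) y z

lemma IsCb.exists_bounds {F₀ : E → F} (hF : IsCb 3 F₀) :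
    ∃ M, HasLipIncr M F₀ ∧ HasLipIncr M (fderiv ℝ F₀) ∧
      (∀ y z w, ‖taylorRem F₀ y w - taylorRem F₀ z w‖ ≤ M * ‖w‖ ^ 2 * ‖y - z‖) ∧
      (∀ z w w', ‖taylorRem F₀ z w - taylorRem F₀ z w'‖ ≤ M * max ‖w‖ ‖w'‖ * ‖w - w'‖) := by
  obtain ⟨hc, M, hM⟩ := hF
  have hc0 : ContDiff ℝ 2 F₀ := hc.of_le (by norm_num)
  have hc1 : ContDiff ℝ 2 (fderiv ℝ F₀) := hc.fderiv_right (by norm_num)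
  have hd0 : Differentiable ℝ F₀ := hc.differentiable (by norm_num)
  have hd1 : Differentiable ℝ (fderiv ℝ F₀) := hc1.differentiable (by norm_num)
  have b0 : ∀ y, ‖F₀ y‖ ≤ M := fun y => by simpa using hM 0 (by norm_num) y
  have b1 : ∀ y, ‖fderiv ℝ F₀ y‖ ≤ M := norm_fderiv_le_of_iteratedFDeriv (hM 1 (by norm_num))
  have b2 : ∀ y, ‖fderiv ℝ (fderiv ℝ F₀) y‖ ≤ M := norm_fderiv_le_of_iteratedFDeriv fun y => by
    rw [norm_iteratedFDeriv_fderiv]; exact hM 2 (by norm_num) y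
  have l1 := norm_fderiv_sub_le_of_iteratedFDeriv hc0 (hM 2 (by norm_num))
  have l2 := norm_fderiv_sub_le_of_iteratedFDeriv hc1 fun y => by
    rw [norm_iteratedFDeriv_fderiv]; exact hM 3 le_rfl y
  have hM0 : 0 ≤ M := (norm_nonneg _).trans (b0 0)
  exact ⟨M, .of_fderiv hd0 b0 b1 l1, .of_fderiv hd1 b1 b2 l2,
    norm_taylorRem_sub_le_left hc0 l2 hM0,
    norm_taylorRem_sub_le_right hd0 l1 hM0⟩

end Calculus

/-! ### Second-order terms and the vector field `Df · f`. -/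

variable {d n : ℕ}

lemma norm_single_one_le (i : Fin d) : ‖(EuclideanSpace.single i (1 : ℝ) : Vec d)‖ ≤ 1 := by simp

lemma norm_tensorApply_le (L : Vec d →L[ℝ] LinVec d n) (A : SqMat d) :
    ‖tensorApply L A‖ ≤ (d * d : ℝ) * ‖L‖ * ‖A‖ := by
  have h : ∀ i j : Fin d, ‖A (i, j) • L (EuclideanSpace.single i (1 : ℝ))
      (EuclideanSpace.single j (1 : ℝ))‖ ≤ ‖L‖ * ‖A‖ := by
    intro i j
    rw [norm_smul, mul_comm]
    gcongr
    · refine ((L _).le_opNorm _).trans ?_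
      refine (mul_le_of_le_one_right (norm_nonneg _) (norm_single_one_le j)).trans ?_
      exact (L.le_opNorm _).trans (mul_le_of_le_one_right (norm_nonneg _) (norm_single_one_le i))
    · exact PiLp.norm_apply_le A (i, j)
  calc _ ≤ ∑ _i : Fin d, ∑ _j : Fin d, ‖L‖ * ‖A‖ :=
        (norm_sum_le _ _).trans (Finset.sum_le_sum fun i _ =>
          (norm_sum_le _ _).trans (Finset.sum_le_sum fun j _ => h i j))
    _ = _ := by simp; ring

/-- `tensorApply` as a continuous bilinear map. -/
def tensorCLM (d n : ℕ) : (Vec d →L[ℝ] LinVec d n) →L[ℝ] SqMat d →L[ℝ] Vec n :=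
  LinearMap.mkContinuous₂
    (LinearMap.mk₂ ℝ tensorApply
      (fun L L' A => by simp [tensorApply, Finset.sum_add_distrib])
      (fun c L A => by simp [tensorApply, Finset.smul_sum, smul_comm c])
      (fun L A A' => by simp [tensorApply, Finset.sum_add_distrib, add_smul])
      (fun c L A => by simp [tensorApply, Finset.smul_sum, mul_smul]))
    (d * d : ℝ) (fun L A => norm_tensorApply_le L A)

lemma norm_tensorCLM_le (L : Vec d →L[ℝ] LinVec d n) : ‖tensorCLM d n L‖ ≤ (d * d : ℝ) * ‖L‖ :=
  ContinuousLinearMap.opNorm_le_bound _ (by positivity) fun A => norm_tensorApply_le L A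

/-- Chen's relation is given in coordinates; through this identity its right-hand side becomes the
term `Df(y)(f(y) x) x'` of the Taylor expansion. -/
lemma tensorApply_tensor (L : Vec d →L[ℝ] LinVec d n) (A : SqMat d) (x x' : Vec d)
    (hA : ∀ i j, A (i, j) = x i * x' j) : tensorApply L A = L x x' := by
  have hx : ∀ v : Vec d, v = ∑ i, v i • EuclideanSpace.single i (1 : ℝ) := by
    intro v
    ext j
    simp [Pi.single_apply]
  conv_rhs => rw [hx x, hx x']
  simp only [tensorApply, hA, map_sum, map_smul, _root_.sum_apply,
    _root_.smul_apply, mul_smul, Finset.smul_sum]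
  rw [Finset.sum_comm]
  refine Finset.sum_congr rfl fun i _ => Finset.sum_congr rfl fun j _ => ?_
  rw [smul_comm]

/-- The second order vector field `G(y) A = (Df(y) f(y)) A`. -/
def secondField (f : Vec n → LinVec d n) (y : Vec n) : SqMat d →L[ℝ] Vec n :=
  tensorCLM d n ((fderiv ℝ f y).comp (f y))

/-- Quantitative consequences of `f ∈ C_b^3`. -/
structure FieldBound (M : ℝ) (f : Vec n → LinVec d n) : Prop where
  fst : HasLipIncr M f
  deriv : HasLipIncr M (fderiv ℝ f)
  snd : HasLipIncr M (secondField f)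
  taylor_left : ∀ y z w, ‖taylorRem f y w - taylorRem f z w‖ ≤ M * ‖w‖ ^ 2 * ‖y - z‖
  taylor_right : ∀ z w w', ‖taylorRem f z w - taylorRem f z w'‖ ≤ M * max ‖w‖ ‖w'‖ * ‖w - w'‖

lemma FieldBound.nonneg {M : ℝ} {f : Vec n → LinVec d n} (h : FieldBound M f) : 0 ≤ M :=
  h.fst.nonneg

lemma FieldBound.taylor {M : ℝ} {f : Vec n → LinVec d n} (h : FieldBound M f) (z w : Vec n) :
    ‖taylorRem f z w‖ ≤ M * ‖w‖ ^ 2 := by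
  have := h.taylor_right z w 0
  simpa [taylorRem, pow_two, mul_assoc] using this

lemma IsCb.exists_fieldBound {f : Vec n → LinVec d n} (hf : IsCb 3 f) :
    ∃ M, 1 ≤ M ∧ FieldBound M f := by
  obtain ⟨M, hf0, hf1, t1, t2⟩ := hf.exists_bounds
  have hM0 := hf0.nonneg
  have hG : HasLipIncr (4 * (d * d) * M * M) (secondField f) :=
    hf1.bilin (LinearMap.mk₂ ℝ
      (fun (L : Vec n →L[ℝ] LinVec d n) (l : LinVec d n) => tensorCLM d n (L.comp l))
      (fun L L' l => by rw [ContinuousLinearMap.add_comp, map_add])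
      (fun c L l => by rw [ContinuousLinearMap.smul_comp, map_smul])
      (fun L l l' => by rw [ContinuousLinearMap.comp_add, map_add])
      (fun c L l => by rw [ContinuousLinearMap.comp_smul, map_smul]))
      (fun L l => (norm_tensorCLM_le _).trans (by
        rw [mul_assoc _ ‖L‖]
        exact mul_le_mul_of_nonneg_left (L.opNorm_comp_le l) (by positivity))) (by positivity) hf0
  have hM' : 0 ≤ 4 * (d * d) * M * M := by positivity
  -- The summand `1` makes the common constant at least `1`, so that lower powers of it can later be
  -- absorbed into its cube.
  have hle : M ≤ M + 4 * (d * d) * M * M + 1 := by linarith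
  refine ⟨M + 4 * (d * d) * M * M + 1, by linarith, hf0.mono hle, hf1.mono hle,
    hG.mono (by linarith), fun y z w => ?_, fun z w w' => ?_⟩
  · exact (t1 y z w).trans (by gcongr)
  · exact (t2 z w w').trans (by gcongr)

/-! ### Almost flows -/

/-- A family `id + ψ s t` of maps of `E` that is a flow up to a superlinear error. -/
structure AlmostFlow {E : Type*} [NormedAddCommGroup E] (T δ a θ L : ℝ) (ψ : ℝ → ℝ → E → E) :
    Prop where
  δ_pos : 0 < δ
  δ_le : δ ≤ 1
  a_pos : 0 < a
  one_lt : 1 < θ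
  L_nonneg : 0 ≤ L
  bound : ∀ s t, 0 ≤ s → s ≤ t → t ≤ T → t - s ≤ δ → ∀ y, ‖ψ s t y‖ ≤ L * (t - s) ^ a
  lip : ∀ s t, 0 ≤ s → s ≤ t → t ≤ T → t - s ≤ δ → ∀ y z,
    ‖ψ s t y - ψ s t z‖ ≤ L * (t - s) ^ a * ‖y - z‖
  incr : ∀ s t, 0 ≤ s → s ≤ t → t ≤ T → t - s ≤ δ → ∀ y z w,
    ‖ψ s t (y + w) - ψ s t y - (ψ s t (z + w) - ψ s t z)‖ ≤ L * (t - s) ^ a * ‖w‖ * ‖y - z‖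
  defect : ∀ s u t, 0 ≤ s → s ≤ u → u ≤ t → t ≤ T → t - s ≤ δ → ∀ y,
    ‖ψ s u y + ψ u t (y + ψ s u y) - ψ s t y‖ ≤ L * (t - s) ^ θ
  defect_lip : ∀ s u t, 0 ≤ s → s ≤ u → u ≤ t → t ≤ T → t - s ≤ δ → ∀ y z,
    ‖(ψ s u y + ψ u t (y + ψ s u y) - ψ s t y) - (ψ s u z + ψ u t (z + ψ s u z) - ψ s t z)‖ ≤
      L * (t - s) ^ θ * ‖y - z‖

lemma exists_small_scale {δ a L ε : ℝ} (hδ : 0 < δ) (ha : 0 < a) (hε : 0 < ε) :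
    ∃ δ' > 0, δ' ≤ δ ∧ ∀ h, 0 ≤ h → h ≤ δ' → L * h ^ a ≤ ε := by
  have h1 : Tendsto (fun h : ℝ => L * h ^ a) (𝓝 0) (𝓝 (L * 0 ^ a)) :=
    ((Real.continuousAt_rpow_const 0 a (Or.inr ha.le)).tendsto).const_mul L
  rw [Real.zero_rpow ha.ne', mul_zero] at h1
  obtain ⟨η, hη, h⟩ := Metric.eventually_nhds_iff.1 (h1.eventually (gt_mem_nhds hε))
  refine ⟨min δ (η / 2), by positivity, min_le_left _ _, fun x hx0 hx => (h ?_).le⟩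
  rw [Real.dist_eq, sub_zero, abs_of_nonneg hx0]
  linarith [hx.trans (min_le_right _ _)]

section Flow

variable {E : Type*} [NormedAddCommGroup E] {T δ a θ L : ℝ} {ψ : ℝ → ℝ → E → E}

/-- The path `Y` follows the almost flow `id + ψ` up to an error of order `θ`. -/
def Follows (T δ θ C : ℝ) (ψ : ℝ → ℝ → E → E) (Y : ℝ → E) : Prop :=
  ∀ s t, 0 ≤ s → s ≤ t → t ≤ T → t - s ≤ δ → ‖Y t - Y s - ψ s t (Y s)‖ ≤ C * (t - s) ^ θ

/-- The error over `[s,t]` at an intermediate point `q`: the first error is transported by the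
Lipschitz map over `[u,t]`, the second is added, and the defect of the almost flow is the remaining
term. This is the almost subadditivity that sewing requires. -/
lemma AlmostFlow.norm_follow_split (H : AlmostFlow T δ a θ L ψ) {s u t : ℝ} (hs : 0 ≤ s)
    (hsu : s ≤ u) (hut : u ≤ t) (ht : t ≤ T) (hst : t - s ≤ δ) (p q r : E) :
    ‖r - p - ψ s t p‖ ≤ (1 + L * (t - u) ^ a) * ‖q - p - ψ s u p‖ + ‖r - q - ψ u t q‖ +
      L * (t - s) ^ θ := by
  have e : r - p - ψ s t p = (q - p - ψ s u p) + (ψ u t q - ψ u t (p + ψ s u p)) +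
      (r - q - ψ u t q) + (ψ s u p + ψ u t (p + ψ s u p) - ψ s t p) := by abel
  have h1 := H.lip u t (hs.trans hsu) hut ht (by linarith) q (p + ψ s u p)
  rw [← sub_sub] at h1
  have h2 := H.defect s u t hs hsu hut ht hst p
  rw [e]
  refine (norm_add₄_le).trans ?_
  linarith

/-- The same splitting for the difference of the errors of two paths. The base points of the
transported errors differ as well, which is where the second-difference bound `incr` enters; it
yields a term of size error times distance. -/
lemma AlmostFlow.norm_follow_sub_split (H : AlmostFlow T δ a θ L ψ) {s u t : ℝ} (hs : 0 ≤ s)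
    (hsu : s ≤ u) (hut : u ≤ t) (ht : t ≤ T) (hst : t - s ≤ δ) (p q r p' q' r' : E) :
    ‖(r - p - ψ s t p) - (r' - p' - ψ s t p')‖ ≤
      (1 + L * (t - u) ^ a) * ‖(q - p - ψ s u p) - (q' - p' - ψ s u p')‖ +
      ‖(r - q - ψ u t q) - (r' - q' - ψ u t q')‖ +
      (L * ‖q' - p' - ψ s u p'‖ * ((1 + L) * ‖p - p'‖) + L * (t - s) ^ θ * ‖p - p'‖) := by
  have hL := H.L_nonneg
  have hLa : ∀ v w, v ≤ w → w - v ≤ δ → L * (w - v) ^ a ≤ L := fun v w h1 h2 =>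
    mul_le_of_le_one_right hL
      (Real.rpow_le_one (by linarith) (h2.trans H.δ_le) H.a_pos.le)
  obtain ⟨y, hy⟩ : ∃ y, y = p + ψ s u p := ⟨_, rfl⟩
  obtain ⟨z, hz⟩ : ∃ z, z = p' + ψ s u p' := ⟨_, rfl⟩
  obtain ⟨v, hv⟩ : ∃ v, v = q - p - ψ s u p := ⟨_, rfl⟩
  obtain ⟨w, hw⟩ : ∃ w, w = q' - p' - ψ s u p' := ⟨_, rfl⟩
  have eq1 : q = y + v := by rw [hy, hv]; abel
  have eq2 : q' = z + w := by rw [hz, hw]; abel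
  have l1 := H.lip u t (hs.trans hsu) hut ht (by linarith) (y + v) (y + w)
  rw [add_sub_add_left_eq_sub] at l1
  have l2 := H.incr u t (hs.trans hsu) hut ht (by linarith) y z w
  have l3 := H.defect_lip s u t hs hsu hut ht hst p p'
  rw [← hy, ← hz] at l3
  have l4 : ‖y - z‖ ≤ (1 + L) * ‖p - p'‖ := by
    have k := H.lip s u hs hsu (by linarith) (by linarith) p p'
    have e : y - z = (p - p') + (ψ s u p - ψ s u p') := by rw [hy, hz]; abel
    rw [e, add_mul, one_mul]
    refine (norm_add_le _ _).trans (add_le_add le_rfl (k.trans ?_))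
    have := hLa s u hsu (by linarith)
    gcongr
  have l5 : ‖ψ u t (y + w) - ψ u t y - (ψ u t (z + w) - ψ u t z)‖ ≤
      L * ‖w‖ * ((1 + L) * ‖p - p'‖) := by
    refine l2.trans ?_
    have := hLa u t hut (by linarith)
    gcongr
  have e : (r - p - ψ s t p) - (r' - p' - ψ s t p') =
      (v - w) + ((r - q - ψ u t q) - (r' - q' - ψ u t q')) +
      (ψ u t (y + v) - ψ u t (y + w)) +
      ((ψ u t (y + w) - ψ u t y - (ψ u t (z + w) - ψ u t z)) +
      ((ψ s u p + ψ u t y - ψ s t p) - (ψ s u p' + ψ u t z - ψ s t p'))) := by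
    rw [← eq1, ← eq2, hv, hw]; abel
  rw [← hv, ← hw, e]
  refine ((norm_add_le _ _).trans (add_le_add norm_add₃_le (norm_add_le _ _))).trans ?_
  linarith

/-- The Euler scheme of mesh `τ`. -/
def euler (ψ : ℝ → ℝ → E → E) (y : E) (τ : ℝ) : ℕ → E
  | 0 => y
  | i + 1 => euler ψ y τ i + ψ (i * τ) ((i + 1 : ℕ) * τ) (euler ψ y τ i)

/-- The Euler error vanishes on single steps, so discrete sewing applies with a constant independent
of mesh and initial value. The scale `δ'` makes the transport factor so close to `1` that its
product with `(2/3)^(θ-1)` stays below the midpoint `(1 + κ₀)/2 < 1`. -/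
lemma AlmostFlow.euler_bound (H : AlmostFlow T δ a θ L ψ) :
    ∃ C δ', 0 ≤ C ∧ 0 < δ' ∧ δ' ≤ δ ∧ ∀ y τ, 0 ≤ τ → ∀ m i : ℕ, (i + m : ℕ) * τ ≤ T →
      m * τ ≤ δ' → ‖euler ψ y τ (i + m) - euler ψ y τ i -
        ψ (i * τ) ((i + m : ℕ) * τ) (euler ψ y τ i)‖ ≤ C * (m * τ) ^ θ := by
  set κ₀ := (2 / 3 : ℝ) ^ (θ - 1) with hκ₀
  have hκ0 : 0 ≤ κ₀ := by positivity
  have hκ1 : κ₀ < 1 := two_thirds_rpow_lt_one H.one_lt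
  obtain ⟨δ', hδ', hδδ, hsmall⟩ := exists_small_scale (L := L) (ε := (1 - κ₀) / 2) H.δ_pos H.a_pos
    (by linarith)
  refine ⟨L / (1 - (1 + κ₀) / 2), δ', div_nonneg H.L_nonneg (by linarith), hδ', hδδ, ?_⟩
  intro y τ hτ m i hi hm
  set e := euler ψ y τ
  have hmono : ∀ i j : ℕ, i ≤ j → (i : ℝ) * τ ≤ j * τ := fun i j hij => by gcongr
  refine discrete_sewing
    (e := fun i j => ‖e j - e i - ψ (i * τ) (j * τ) (e i)‖)
    (P := fun i j => (j : ℝ) * τ ≤ T ∧ (j : ℝ) * τ - i * τ ≤ δ')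
    (A := 1 + (1 - κ₀) / 2) (κ := (1 + κ₀) / 2) ?_ H.one_lt hτ (by linarith) H.L_nonneg
    (by nlinarith) (by linarith) ?_ ?_ ?_ m i ⟨hi, ?_⟩
  · rintro i k j hik hkj ⟨h1, h2⟩
    exact ⟨⟨(hmono k j hkj).trans h1, by linarith [hmono k j hkj]⟩, h1,
      by linarith [hmono i k hik]⟩
  · rintro i ⟨h1, -⟩
    have := H.bound (i * τ) (i * τ) (by positivity) le_rfl h1 (by simpa using H.δ_pos.le) (e i)
    rw [sub_self, Real.zero_rpow H.a_pos.ne', mul_zero] at this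
    simpa using this
  · rintro i -
    simp [e, euler]
  · rintro i k j hik hkj ⟨h1, h2⟩
    have m1 := hmono i k hik.le
    have m2 := hmono k j hkj.le
    have := H.norm_follow_split (s := i * τ) (u := k * τ) (t := j * τ) (by positivity) m1 m2 h1
      (by linarith) (e i) (e k) (e j)
    have h3 := hsmall (j * τ - k * τ) (by linarith) (by linarith)
    rw [sub_mul]
    refine this.trans ?_
    gcongr
  · push_cast; linarith

lemma AlmostFlow.norm_path_le (H : AlmostFlow T δ a θ L ψ) {s t C : ℝ} (hs : 0 ≤ s) (hst : s ≤ t)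
    (ht : t ≤ T) (hδ : t - s ≤ δ) (hC : 0 ≤ C) {p q : E}
    (h : ‖q - p - ψ s t p‖ ≤ C * (t - s) ^ θ) : ‖q - p‖ ≤ L + C := by
  have h0 : 0 ≤ t - s := by linarith
  have h1 : (t - s) ^ a ≤ 1 := Real.rpow_le_one h0 (hδ.trans H.δ_le) H.a_pos.le
  have h2 : (t - s) ^ θ ≤ 1 := Real.rpow_le_one h0 (hδ.trans H.δ_le) (by linarith [H.one_lt])
  calc ‖q - p‖ = ‖ψ s t p + (q - p - ψ s t p)‖ := by congr 1; abel
    _ ≤ L * (t - s) ^ a + C * (t - s) ^ θ :=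
      (norm_add_le _ _).trans (add_le_add (H.bound s t hs hst ht hδ p) h)
    _ ≤ L * 1 + C * 1 := by gcongr; exact H.L_nonneg
    _ = L + C := by ring

/-- Existence of a path that follows an almost flow: a limit point of the Euler schemes. -/
lemma AlmostFlow.exists_follows [ProperSpace E] (H : AlmostFlow T δ a θ L ψ)
    (hcont : ∀ (U : Filter ℕ) (σ ρ : ℕ → ℝ) (z : ℕ → E) (s t : ℝ) (y : E), s < t → t ≤ T →
      (∀ᶠ m in U, 0 ≤ σ m ∧ σ m ≤ s ∧ s ≤ ρ m ∧ ρ m ≤ t) → Tendsto σ U (𝓝 s) →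
      Tendsto ρ U (𝓝 t) → Tendsto z U (𝓝 y) →
      Tendsto (fun m => ψ (σ m) (ρ m) (z m)) U (𝓝 (ψ s t y))) (y : E) :
    ∃ Y : ℝ → E, Y 0 = y ∧ ∃ C δ', 0 ≤ C ∧ 0 < δ' ∧ δ' ≤ δ ∧ Follows T δ' θ C ψ Y := by
  obtain ⟨C, δ', hC, hδ', hδδ, hE⟩ := H.euler_bound
  set τ : ℕ → ℝ := fun m => 1 / ((m : ℝ) + 1) with hτ
  have hτ0 : ∀ m, 0 < τ m := fun m => by simp only [hτ]; positivity
  -- The scheme of mesh `τ m` is extended to a step function: `g m t` is the last grid point not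
  -- after `t`, and `W m t` the value there.
  set idx : ℕ → ℝ → ℕ := fun m t => ⌊t / τ m⌋₊ with hidx
  set g : ℕ → ℝ → ℝ := fun m t => idx m t * τ m with hg
  set W : ℕ → ℝ → E := fun m t => euler ψ y (τ m) (idx m t) with hW
  have hg0 : ∀ m t, 0 ≤ g m t := fun m t => by
    have := (hτ0 m).le
    simp only [hg]; positivity
  have hgle : ∀ m t, 0 ≤ t → g m t ≤ t := fun m t ht => by
    have := Nat.floor_le (div_nonneg ht (hτ0 m).le)
    simp only [hg, hidx]
    rwa [le_div_iff₀ (hτ0 m)] at this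
  have hglt : ∀ m t, t < g m t + τ m := fun m t => by
    have := Nat.lt_floor_add_one (t / τ m)
    rw [div_lt_iff₀ (hτ0 m), add_mul, one_mul] at this
    exact this
  have hest : ∀ m s t, 0 ≤ s → s ≤ t → t ≤ T → g m t - g m s ≤ δ' →
      ‖W m t - W m s - ψ (g m s) (g m t) (W m s)‖ ≤ C * (g m t - g m s) ^ θ ∧ g m s ≤ g m t := by
    intro m s t hs hst ht hd
    have hi : idx m s ≤ idx m t := by
      simp only [hidx]
      have := (hτ0 m).le
      gcongr
    obtain ⟨k, hk⟩ := Nat.exists_eq_add_of_le hi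
    have e1 : g m t - g m s = k * τ m := by simp only [hg, hk]; push_cast; ring
    have := hE y (τ m) (hτ0 m).le k (idx m s) (by
      rw [← hk]; exact (hgle m t (hs.trans hst)).trans ht) (by rw [← e1]; exact hd)
    rw [← hk, ← e1] at this
    refine ⟨this, ?_⟩
    have : 0 ≤ k * τ m := mul_nonneg k.cast_nonneg (hτ0 m).le
    linarith
  have hτlim : Tendsto τ atTop (𝓝 0) := tendsto_one_div_add_atTop_nhds_zero_nat
  have hglim : ∀ t, 0 ≤ t → Tendsto (fun m => g m t) atTop (𝓝 t) := fun t ht => by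
    refine tendsto_of_tendsto_of_tendsto_of_le_of_le (g := fun m => t - τ m) (h := fun _ => t)
      (by simpa using hτlim.const_sub t) tendsto_const_nhds (fun m => ?_) (fun m => hgle m t ht)
    have := hglt m t
    simp only; linarith
  have hW0 : ∀ m, W m 0 = y := fun m => by simp [hW, hidx, euler]
  -- Stability by steps of length `δ' / 2`: rounding to the grid lengthens a step by at most `τ m ≤
  -- δ' / 2`, so the local bound at scale `δ'` still applies.
  have hbdd : ∀ m, τ m ≤ δ' / 2 → ∀ k : ℕ, ∀ t, 0 ≤ t → t ≤ T → t ≤ k * (δ' / 2) →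
      ‖W m t - y‖ ≤ k * (L + C) := by
    intro m hm k
    induction k with
    | zero =>
      intro t h0 _ h1
      have : t = 0 := le_antisymm (by simpa using h1) h0
      subst this
      simp [hW0]
    | succ k ih =>
      intro t h0 hT h1
      have hs0 : 0 ≤ max 0 (t - δ' / 2) := le_max_left _ _
      have hst : max 0 (t - δ' / 2) ≤ t := max_le h0 (by linarith)
      have hst' : t - δ' / 2 ≤ max 0 (t - δ' / 2) := le_max_right _ _
      set s := max 0 (t - δ' / 2) with hsdef
      have hsk : s ≤ k * (δ' / 2) := by
        push_cast at h1
        exact max_le (by positivity) (by linarith)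
      have h2 := ih s hs0 (hst.trans hT) hsk
      have hgd : g m t - g m s ≤ δ' := by
        linarith [hgle m t h0, hglt m s]
      obtain ⟨h3, h4⟩ := hest m s t hs0 hst hT hgd
      have h5 := H.norm_path_le (hg0 m s) h4 ((hgle m t h0).trans hT) (hgd.trans hδδ) hC h3
      calc ‖W m t - y‖ ≤ ‖W m t - W m s‖ + ‖W m s - y‖ := norm_sub_le_norm_sub_add_norm_sub _ _ _
        _ ≤ (L + C) + k * (L + C) := add_le_add h5 h2
        _ = _ := by push_cast; ring
  have hτev : ∀ᶠ m in atTop, τ m ≤ δ' / 2 :=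
    hτlim.eventually (ge_mem_nhds (by positivity))
  have hUle : (hyperfilter ℕ : Filter ℕ) ≤ atTop := by
    rw [← Nat.cofinite_eq_atTop]; exact hyperfilter_le_cofinite
  -- Limits along a single ultrafilter exist for all `t` simultaneously by compactness of balls, so
  -- neither a subsequence nor equicontinuity is needed.
  have hlim : ∀ t, ∃ z, 0 ≤ t → t ≤ T → Tendsto (fun m => W m t) (hyperfilter ℕ) (𝓝 z) := by
    intro t
    by_cases h : 0 ≤ t ∧ t ≤ T
    · obtain ⟨k, hk⟩ := exists_nat_ge (t / (δ' / 2))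
      rw [div_le_iff₀ (by positivity)] at hk
      have hmem : ∀ᶠ m in (hyperfilter ℕ : Filter ℕ), W m t ∈ Metric.closedBall y (k * (L + C)) := by
        filter_upwards [hUle hτev] with m hm
        rw [Metric.mem_closedBall, dist_eq_norm]
        exact hbdd m hm k t h.1 h.2 hk
      obtain ⟨z, -, hz⟩ := (isCompact_closedBall y (k * (L + C))).ultrafilter_le_nhds
        ((hyperfilter ℕ).map fun m => W m t) (le_principal_iff.2 hmem)
      exact ⟨z, fun _ _ => hz⟩
    · exact ⟨0, fun h1 h2 => absurd ⟨h1, h2⟩ h⟩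
  choose Y hY using hlim
  refine ⟨fun t => if 0 ≤ t ∧ t ≤ T then Y t else y, ?_, C, δ' / 2, hC, by positivity, by linarith, ?_⟩
  · simp only
    split_ifs with h
    · have := hY 0 h.1 h.2
      simp only [hW0] at this
      exact tendsto_nhds_unique this tendsto_const_nhds
    · rfl
  · intro s t hs hst ht hd
    simp only [hs, hst.trans ht, hs.trans hst, ht, and_self, if_true]
    -- The continuity hypothesis needs `s ≤ g m t` eventually, which requires `s < t`; the diagonal
    -- is trivial.
    rcases hst.eq_or_lt with rfl | hlt
    · have := H.bound s s hs le_rfl ht (by simpa using H.δ_pos.le) (Y s)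
      rw [sub_self, Real.zero_rpow H.a_pos.ne', mul_zero] at this
      rw [sub_self, zero_sub, norm_neg, sub_self, Real.zero_rpow (by linarith [H.one_lt]), mul_zero]
      exact this
    · have hYs := hY s hs (hst.trans ht)
      have hYt := hY t (hs.trans hst) ht
      have hgs := (hglim s hs).mono_left hUle
      have hgt := (hglim t (hs.trans hst)).mono_left hUle
      have hev : ∀ᶠ m in (hyperfilter ℕ : Filter ℕ),
          0 ≤ g m s ∧ g m s ≤ s ∧ s ≤ g m t ∧ g m t ≤ t := by
        filter_upwards [hgt.eventually (le_mem_nhds hlt)] with m hm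
        exact ⟨hg0 m s, hgle m s hs, hm, hgle m t (hs.trans hst)⟩
      have hψ := hcont (hyperfilter ℕ) (fun m => g m s) (fun m => g m t) (fun m => W m s) s t (Y s)
        hlt ht hev hgs hgt hYs
      refine le_of_tendsto_of_tendsto ((hYt.sub hYs).sub hψ).norm
        (((hgt.sub hgs).rpow_const (Or.inr (by linarith [H.one_lt]))).const_mul C) ?_
      filter_upwards [hUle hτev] with m hm
      exact (hest m s t hs hst ht (by
        linarith [hgle m t (hs.trans hst), hglt m s])).1

/-- If the paths are `M`-close on a short window, midpoint splitting bounds the difference of their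
errors by a multiple of `M (t-s)^θ`. As the paths agree at `c`, their distance at `t` is such a
difference over `[c,t]`, hence at most `M / 2` on a small window. Iteration makes it zero. -/
lemma AlmostFlow.exists_unique_scale (H : AlmostFlow T δ a θ L ψ) {C : ℝ} (hC : 0 ≤ C) :
    ∃ δ' > 0, δ' ≤ δ ∧ ∀ Y Z : ℝ → E, Follows T δ θ C ψ Y → Follows T δ θ C ψ Z →
      ∀ c, 0 ≤ c → Y c = Z c → ∀ t, c ≤ t → t ≤ c + δ' → t ≤ T → Y t = Z t := by
  have hL := H.L_nonneg
  set κ₀ := 2 * (1 / 2 : ℝ) ^ θ with hκ₀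
  have hhalf : 0 < (1 / 2 : ℝ) ^ θ := by positivity
  have hκ1 : κ₀ < 1 := by
    have : (1 / 2 : ℝ) ^ θ < (1 / 2 : ℝ) ^ (1 : ℝ) :=
      Real.rpow_lt_rpow_of_exponent_gt (by norm_num) (by norm_num) H.one_lt
    rw [Real.rpow_one] at this
    linarith
  obtain ⟨δ₁, hδ₁, hδδ₁, hsmall⟩ := exists_small_scale (L := L) (ε := (1 - κ₀) / 2) H.δ_pos H.a_pos
    (by linarith)
  set κ := (1 + κ₀) / 2 with hκ
  -- The coefficient of `‖p - p'‖` in `norm_follow_sub_split`, with the error of the second path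
  -- bounded by `C (t-s)^θ`.
  set b := L * C * (1 + L) + L with hb
  have hb0 : 0 ≤ b := by positivity
  obtain ⟨δ', hδ', hδδ, hsmall'⟩ := exists_small_scale (L := b / (1 - κ)) (ε := 1 / 2) hδ₁
    (by linarith [H.one_lt] : 0 < θ) (by norm_num)
  refine ⟨δ', hδ', hδδ.trans hδδ₁, ?_⟩
  intro Y Z hY hZ c hc hYZ
  have hδ1 := H.δ_le
  -- the errors of `Y` and `Z` differ by a multiple of the distance of the paths
  have hD : ∀ M, (∀ t ∈ {t | c ≤ t ∧ t ≤ c + δ' ∧ t ≤ T}, ‖Y t - Z t‖ ≤ M * 1) →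
      ∀ p ∈ {p : ℝ × ℝ | c ≤ p.1 ∧ p.1 ≤ p.2 ∧ p.2 ≤ c + δ' ∧ p.2 ≤ T},
        ‖(Y p.2 - Y p.1 - ψ p.1 p.2 (Y p.1)) - (Z p.2 - Z p.1 - ψ p.1 p.2 (Z p.1))‖ ≤
          (b * M) / (1 - κ) * (p.2 - p.1) ^ θ := by
    intro M hM
    refine le_of_contraction (N := C + C) (by positivity) (by linarith) ?_ ?_
    · rintro ⟨s, t⟩ ⟨h1, h2, h3, h4⟩
      dsimp only at h1 h2 h3 h4 ⊢
      rw [add_mul]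
      exact (norm_sub_le _ _).trans (add_le_add
        (hY s t (by linarith) h2 h4 (by linarith)) (hZ s t (by linarith) h2 h4 (by linarith)))
    · rintro N hN ⟨s, t⟩ ⟨h1, h2, h3, h4⟩
      dsimp only at h1 h2 h3 h4 ⊢
      set u := (s + t) / 2 with hu
      have hsu : s ≤ u := by linarith
      have hut : u ≤ t := by linarith
      have hs0 : 0 ≤ s := hc.trans h1
      have hd : t - s ≤ δ' := by linarith
      have D1 := hN (s, u) ⟨h1, hsu, by dsimp only; linarith, by dsimp only; linarith⟩
      have D2 := hN (u, t) ⟨h1.trans hsu, hut, h3, h4⟩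
      dsimp only at D1 D2
      have hh : ∀ v w : ℝ, w - v = (t - s) / 2 → (w - v) ^ θ = (1 / 2 : ℝ) ^ θ * (t - s) ^ θ := by
        intro v w hvw
        rw [hvw, ← Real.mul_rpow (by norm_num) (by linarith)]
        congr 1; ring
      rw [hh s u (by rw [hu]; ring)] at D1
      rw [hh u t (by rw [hu]; ring)] at D2
      have l0 : L * (t - u) ^ a ≤ (1 - κ₀) / 2 := hsmall _ (by linarith) (by linarith)
      have hM0 : ‖Y s - Z s‖ ≤ M := by
        have := hM s ⟨h1, by linarith, by linarith⟩; linarith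
      have hMn : 0 ≤ M := (norm_nonneg _).trans hM0
      have hh0 : 0 ≤ t - s := by linarith
      have hq : 0 ≤ (t - s) ^ θ := Real.rpow_nonneg hh0 _
      have l5 : ‖Z u - Z s - ψ s u (Z s)‖ ≤ C * (t - s) ^ θ := by
        refine (hZ s u hs0 hsu (by linarith) (by linarith)).trans ?_
        rw [hh s u (by rw [hu]; ring)]
        gcongr
        refine mul_le_of_le_one_left hq ?_
        linarith
      have key := H.norm_follow_sub_split hs0 hsu hut h4 (by linarith) (Y s) (Y u) (Y t)
        (Z s) (Z u) (Z t)
      generalize (t - s) ^ θ = q at *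
      refine key.trans ?_
      -- No sign of `N` is assumed in the iteration; the sign of the product comes from the norm
      -- bound `D1`.
      have hN0 : 0 ≤ N * q := by
        have := (norm_nonneg _).trans D1
        have h' : 0 ≤ (1 / 2 : ℝ) ^ θ * (N * q) := by linarith
        exact nonneg_of_mul_nonneg_right h' hhalf
      calc _ ≤ (1 + (1 - κ₀) / 2) * (N * ((1 / 2 : ℝ) ^ θ * q)) + N * ((1 / 2 : ℝ) ^ θ * q) +
            (L * (C * q) * ((1 + L) * M) + L * q * M) := by
            have : 0 ≤ 1 + (1 - κ₀) / 2 := by linarith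
            gcongr
        _ = N * q * (κ₀ + (1 - κ₀) / 2 * (1 / 2 : ℝ) ^ θ) + b * M * q := by
            rw [hb, hκ₀]; ring
        _ ≤ N * q * κ + b * M * q := by
            have : κ₀ + (1 - κ₀) / 2 * (1 / 2 : ℝ) ^ θ ≤ κ := by
              rw [hκ]; nlinarith
            gcongr
        _ = (κ * N + b * M) * q := by ring
  have hfin := le_of_contraction (S := {t | c ≤ t ∧ t ≤ c + δ' ∧ t ≤ T})
    (u := fun t => ‖Y t - Z t‖) (w := fun _ => 1) (κ := 1 / 2) (b := 0)
    (N := (L + C) + (L + C)) (by norm_num) (by norm_num) ?_ ?_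
  · intro t h1 h2 h3
    have := hfin t ⟨h1, h2, h3⟩
    simp only [zero_div, zero_mul] at this
    exact sub_eq_zero.1 (norm_le_zero_iff.1 this)
  · rintro t ⟨h1, h2, h3⟩
    have a1 := H.norm_path_le hc h1 h3 (by linarith) hC (hY c t hc h1 h3 (by linarith))
    have a2 := H.norm_path_le hc h1 h3 (by linarith) hC (hZ c t hc h1 h3 (by linarith))
    rw [mul_one]
    calc ‖Y t - Z t‖ = ‖(Y t - Y c) - (Z t - Z c)‖ := by rw [hYZ]; congr 1; abel
      _ ≤ _ := (norm_sub_le _ _).trans (add_le_add a1 a2)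
  · rintro M hM t ⟨h1, h2, h3⟩
    have := hD M hM (c, t) ⟨le_rfl, h1, h2, h3⟩
    dsimp only at this
    rw [hYZ] at this
    have hM0 : 0 ≤ M := by
      have := (norm_nonneg _).trans (hM c ⟨le_rfl, by linarith, by linarith⟩)
      linarith
    have h5 := hsmall' (t - c) (by linarith) (by linarith)
    calc ‖Y t - Z t‖ = ‖Y t - Z c - ψ c t (Z c) - (Z t - Z c - ψ c t (Z c))‖ := by
          congr 1; abel
      _ ≤ b * M / (1 - κ) * (t - c) ^ θ := this
      _ = (b / (1 - κ) * (t - c) ^ θ) * M := by ring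
      _ ≤ 1 / 2 * M := by gcongr
      _ = (1 / 2 * M + 0) * 1 := by ring

/-- Paths that follow an almost flow are determined by their initial value. -/
lemma AlmostFlow.unique (H : AlmostFlow T δ a θ L ψ) {C : ℝ} (hC : 0 ≤ C) {Y Z : ℝ → E}
    (hY : Follows T δ θ C ψ Y) (hZ : Follows T δ θ C ψ Z) (h0 : Y 0 = Z 0) :
    Set.EqOn Y Z (Set.Icc 0 T) := by
  obtain ⟨δ', hδ', -, hloc⟩ := H.exists_unique_scale hC
  have h : ∀ k : ℕ, ∀ t, 0 ≤ t → t ≤ T → t ≤ k * δ' → Y t = Z t := by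
    intro k
    induction k with
    | zero =>
      intro t ht _ h
      have : t = 0 := le_antisymm (by simpa using h) ht
      rw [this, h0]
    | succ k ih =>
      intro t ht hT h
      push_cast at h
      have hc : max 0 (t - δ') ≤ t := max_le ht (by linarith)
      refine hloc Y Z hY hZ (max 0 (t - δ')) (le_max_left _ _) (ih _ (le_max_left _ _)
        (hc.trans hT) (max_le (by positivity) (by linarith))) t hc ?_ hT
      linarith [le_max_right 0 (t - δ')]
  intro t ht
  obtain ⟨k, hk⟩ := exists_nat_ge (t / δ')
  exact h k t ht.1 ht.2 ((div_le_iff₀ hδ').1 hk)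

end Flow

/-! ### The almost flow of a rough differential equation -/

section Incr

variable {d n : ℕ} {f : Vec n → LinVec d n} {M r : ℝ}

/-- The second order increment `f(y) x + Df(y) f(y) A`. -/
def incr (f : Vec n → LinVec d n) (x : Vec d) (A : SqMat d) (y : Vec n) : Vec n :=
  f y x + secondField f y A

lemma norm_apply_add_apply_le {E F G : Type*} [NormedAddCommGroup E] [NormedSpace ℝ E]
    [NormedAddCommGroup F] [NormedSpace ℝ F] [NormedAddCommGroup G] [NormedSpace ℝ G]
    {P : E →L[ℝ] G} {Q : F →L[ℝ] G} {x : E} {A : F} {c r : ℝ} (hP : ‖P‖ ≤ c) (hQ : ‖Q‖ ≤ c)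
    (hx : ‖x‖ ≤ r) (hA : ‖A‖ ≤ r ^ 2) (hr : r ≤ 1) : ‖P x + Q A‖ ≤ 2 * c * r := by
  have hc : 0 ≤ c := (norm_nonneg _).trans hP
  have hr0 : 0 ≤ r := (norm_nonneg _).trans hx
  have hA' : ‖A‖ ≤ r := hA.trans (by nlinarith)
  calc _ ≤ ‖P‖ * ‖x‖ + ‖Q‖ * ‖A‖ :=
        (norm_add_le _ _).trans (add_le_add (P.le_opNorm x) (Q.le_opNorm A))
    _ ≤ c * r + c * r := by gcongr
    _ = _ := by ring

lemma FieldBound.norm_incr_le (hf : FieldBound M f) {x : Vec d} {A : SqMat d}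
    (hx : ‖x‖ ≤ r) (hA : ‖A‖ ≤ r ^ 2) (hr : r ≤ 1) (y : Vec n) :
    ‖incr f x A y‖ ≤ 2 * M * r :=
  norm_apply_add_apply_le (hf.fst.bound y) (hf.snd.bound y) hx hA hr

lemma FieldBound.norm_incr_sub_le (hf : FieldBound M f) {x : Vec d} {A : SqMat d}
    (hx : ‖x‖ ≤ r) (hA : ‖A‖ ≤ r ^ 2) (hr : r ≤ 1) (y z : Vec n) :
    ‖incr f x A y - incr f x A z‖ ≤ 2 * M * r * ‖y - z‖ := by
  have e : incr f x A y - incr f x A z =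
      (f y - f z) x + (secondField f y - secondField f z) A := by
    simp only [incr, _root_.sub_apply]; abel
  rw [e]
  refine (norm_apply_add_apply_le (hf.fst.lip y z) (hf.snd.lip y z) hx hA hr).trans_eq (by ring)

lemma FieldBound.norm_incr_incr_le (hf : FieldBound M f) {x : Vec d} {A : SqMat d}
    (hx : ‖x‖ ≤ r) (hA : ‖A‖ ≤ r ^ 2) (hr : r ≤ 1) (y z w : Vec n) :
    ‖incr f x A (y + w) - incr f x A y - (incr f x A (z + w) - incr f x A z)‖ ≤
      2 * M * r * ‖w‖ * ‖y - z‖ := by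
  have e : incr f x A (y + w) - incr f x A y - (incr f x A (z + w) - incr f x A z) =
      (f (y + w) - f y - (f (z + w) - f z)) x + (secondField f (y + w) - secondField f y -
        (secondField f (z + w) - secondField f z)) A := by
    simp only [incr, _root_.sub_apply]; abel
  rw [e]
  refine (norm_apply_add_apply_le (hf.fst.incr y z w) (hf.snd.incr y z w) hx hA hr).trans_eq
    (by ring)

/-- Chen's relation turns the defect of the second order increments into Taylor remainders. -/
lemma incr_defect_eq (f : Vec n → LinVec d n) {x x' x'' : Vec d} {A A' A'' : SqMat d}
    (hx : x'' = x + x') (hA : ∀ i j, (A'' - A - A') (i, j) = x i * x' j) (y z : Vec n) :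
    incr f x A y + incr f x' A' z - incr f x'' A'' y =
      (f z - f y - fderiv ℝ f y (f y x)) x' + (secondField f z - secondField f y) A' := by
  have h1 : secondField f y (A'' - A - A') = fderiv ℝ f y (f y x) x' :=
    tensorApply_tensor _ _ _ _ hA
  have h2 : secondField f y A'' = secondField f y A + secondField f y A' +
      fderiv ℝ f y (f y x) x' := by
    rw [← h1, map_sub, map_sub]; abel
  simp only [incr, hx, h2, map_add, _root_.sub_apply]
  abel

/-- The intermediate point `z` is arbitrary: it is `y` plus the scheme increment for the almost
flow, and the value of the path at the intermediate time for a solution. -/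
lemma FieldBound.norm_incr_defect_le (hf : FieldBound M f) {x x' x'' : Vec d}
    {A A' A'' : SqMat d} (hx : x'' = x + x') (hA : ∀ i j, (A'' - A - A') (i, j) = x i * x' j)
    (y z : Vec n) :
    ‖incr f x A y + incr f x' A' z - incr f x'' A'' y‖ ≤
      M * (‖z - y‖ ^ 2 + ‖z - y - f y x‖) * ‖x'‖ + M * ‖z - y‖ * ‖A'‖ := by
  rw [incr_defect_eq f hx hA]
  have h1 : f z - f y - fderiv ℝ f y (f y x) =
      taylorRem f y (z - y) + fderiv ℝ f y (z - y - f y x) := by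
    simp only [taylorRem, map_sub, add_sub_cancel]; abel
  have h2 : ‖f z - f y - fderiv ℝ f y (f y x)‖ ≤ M * (‖z - y‖ ^ 2 + ‖z - y - f y x‖) := by
    rw [h1, mul_add]
    refine (norm_add_le _ _).trans (add_le_add (hf.taylor _ _) ?_)
    exact (ContinuousLinearMap.le_opNorm _ _).trans (by gcongr; exact hf.deriv.bound y)
  refine (norm_add_le _ _).trans (add_le_add ?_ ?_)
  · exact (ContinuousLinearMap.le_opNorm _ _).trans (by gcongr)
  · exact (ContinuousLinearMap.le_opNorm _ _).trans (by gcongr; exact hf.snd.lip z y)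

lemma FieldBound.norm_incr_flow_defect_le (hf : FieldBound M f) (hM : 1 ≤ M) {x x' x'' : Vec d}
    {A A' A'' : SqMat d} (hx : x'' = x + x') (hA : ∀ i j, (A'' - A - A') (i, j) = x i * x' j)
    (hr : r ≤ 1) (bx : ‖x‖ ≤ r) (bx' : ‖x'‖ ≤ r) (bA : ‖A‖ ≤ r ^ 2) (bA' : ‖A'‖ ≤ r ^ 2)
    (y : Vec n) :
    ‖incr f x A y + incr f x' A' (y + incr f x A y) - incr f x'' A'' y‖ ≤ 18 * M ^ 3 * r ^ 3 := by
  have hr0 : 0 ≤ r := (norm_nonneg _).trans bx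
  have h1 := hf.norm_incr_le bx bA hr y
  refine (hf.norm_incr_defect_le hx hA y _).trans ?_
  have h2 : y + incr f x A y - y - f y x = secondField f y A := by simp [incr]
  have h3 : ‖secondField f y A‖ ≤ M * r ^ 2 :=
    (ContinuousLinearMap.le_opNorm _ _).trans (by gcongr; exact hf.snd.bound y)
  rw [h2, add_sub_cancel_left]
  calc _ ≤ M * ((2 * M * r) ^ 2 + M * r ^ 2) * r + M * (2 * M * r) * r ^ 2 := by
        gcongr
    _ = (4 * M ^ 3 + 3 * M ^ 2) * r ^ 3 := by ring
    _ ≤ 18 * M ^ 3 * r ^ 3 := by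
        gcongr
        nlinarith [mul_nonneg (sq_nonneg M) (sub_nonneg.2 hM)]

/-- Each factor in the identity for the defect is Lipschitz in the base point with the right power
of `r`, by the two Taylor estimates and the bounds on `secondField f`. The terms sum to `12 M³ + 6
M²`, and `M ≥ 1` gives `18 M³`. -/
lemma FieldBound.norm_incr_flow_defect_sub_le (hf : FieldBound M f) (hM : 1 ≤ M)
    {x x' x'' : Vec d} {A A' A'' : SqMat d} (hx : x'' = x + x')
    (hA : ∀ i j, (A'' - A - A') (i, j) = x i * x' j)
    (hr : r ≤ 1) (bx : ‖x‖ ≤ r) (bx' : ‖x'‖ ≤ r) (bA : ‖A‖ ≤ r ^ 2) (bA' : ‖A'‖ ≤ r ^ 2)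
    (y z : Vec n) :
    ‖(incr f x A y + incr f x' A' (y + incr f x A y) - incr f x'' A'' y) -
      (incr f x A z + incr f x' A' (z + incr f x A z) - incr f x'' A'' z)‖ ≤
      18 * M ^ 3 * r ^ 3 * ‖y - z‖ := by
  have hr0 : 0 ≤ r := (norm_nonneg _).trans bx
  rw [incr_defect_eq f hx hA, incr_defect_eq f hx hA]
  have hw := hf.norm_incr_le bx bA hr
  have hl := hf.norm_incr_sub_le bx bA hr y z
  obtain ⟨v, hv⟩ : ∃ v, v = incr f x A y := ⟨_, rfl⟩
  obtain ⟨w, hw'⟩ : ∃ w, w = incr f x A z := ⟨_, rfl⟩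
  have bv : ‖v‖ ≤ 2 * M * r := hv ▸ hw y
  have bw : ‖w‖ ≤ 2 * M * r := hw' ▸ hw z
  rw [← hv, ← hw'] at hl ⊢
  set D := ‖y - z‖
  have hD : 0 ≤ D := norm_nonneg _
  have key : ∀ y v, v = incr f x A y → f (y + v) - f y - fderiv ℝ f y (f y x) =
      taylorRem f y v + fderiv ℝ f y (secondField f y A) := by
    rintro y v rfl
    rw [taylorRem, incr, map_add]; abel
  have h1 : ‖(f (y + v) - f y - fderiv ℝ f y (f y x)) -
      (f (z + w) - f z - fderiv ℝ f z (f z x))‖ ≤ (12 * M ^ 3 + 2 * M ^ 2) * r ^ 2 * D := by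
    have e : (f (y + v) - f y - fderiv ℝ f y (f y x)) -
        (f (z + w) - f z - fderiv ℝ f z (f z x)) =
        (taylorRem f y v - taylorRem f z v) + (taylorRem f z v - taylorRem f z w) +
        ((fderiv ℝ f y - fderiv ℝ f z) (secondField f y A) +
        fderiv ℝ f z ((secondField f y - secondField f z) A)) := by
      rw [key y v hv, key z w hw']
      simp only [_root_.sub_apply, map_sub]; abel
    have t1 := hf.taylor_left y z v
    have t2 := hf.taylor_right z v w
    have t3 : ‖(fderiv ℝ f y - fderiv ℝ f z) (secondField f y A)‖ ≤ M * D * (M * r ^ 2) := by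
      refine (ContinuousLinearMap.le_opNorm _ _).trans ?_
      gcongr
      · exact hf.deriv.lip y z
      · exact (ContinuousLinearMap.le_opNorm _ _).trans (by gcongr; exact hf.snd.bound y)
    have t4 : ‖fderiv ℝ f z ((secondField f y - secondField f z) A)‖ ≤ M * (M * D * r ^ 2) := by
      refine (ContinuousLinearMap.le_opNorm _ _).trans ?_
      gcongr
      · exact hf.deriv.bound z
      · exact (ContinuousLinearMap.le_opNorm _ _).trans (by gcongr; exact hf.snd.lip y z)
    rw [e]
    have hM0 : 0 ≤ M := by linarith
    calc _ ≤ M * ‖v‖ ^ 2 * D + M * max ‖v‖ ‖w‖ * ‖v - w‖ +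
          (M * D * (M * r ^ 2) + M * (M * D * r ^ 2)) :=
          (norm_add_le _ _).trans (add_le_add ((norm_add_le _ _).trans (add_le_add t1 t2))
            ((norm_add_le _ _).trans (add_le_add t3 t4)))
      _ ≤ M * (2 * M * r) ^ 2 * D + M * (2 * M * r) * (2 * M * r * D) +
          (M * D * (M * r ^ 2) + M * (M * D * r ^ 2)) := by
          have := max_le bv bw
          gcongr
      _ = (8 * M ^ 3 + 2 * M ^ 2) * r ^ 2 * D := by ring
      _ ≤ _ := by gcongr; norm_num
  have h2 : ‖(secondField f (y + v) - secondField f y) -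
      (secondField f (z + w) - secondField f z)‖ ≤ 4 * M ^ 2 * r * D := by
    have e : (secondField f (y + v) - secondField f y) -
        (secondField f (z + w) - secondField f z) =
        (secondField f (y + v) - secondField f y - (secondField f (z + v) - secondField f z)) +
        (secondField f (z + v) - secondField f (z + w)) := by abel
    have t1 := hf.snd.incr y z v
    have t2 := hf.snd.lip (z + v) (z + w)
    rw [add_sub_add_left_eq_sub] at t2
    rw [e]
    calc _ ≤ M * ‖v‖ * D + M * ‖v - w‖ := (norm_add_le _ _).trans (add_le_add t1 t2)
      _ ≤ M * (2 * M * r) * D + M * (2 * M * r * D) := by gcongr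
      _ = _ := by ring
  rw [add_sub_add_comm, ← _root_.sub_apply, ← _root_.sub_apply]
  calc _ ≤ (12 * M ^ 3 + 2 * M ^ 2) * r ^ 2 * D * r + 4 * M ^ 2 * r * D * r ^ 2 := by
        refine (norm_add_le _ _).trans (add_le_add ?_ ?_)
        · exact (ContinuousLinearMap.le_opNorm _ _).trans (by gcongr)
        · exact (ContinuousLinearMap.le_opNorm _ _).trans (by gcongr)
    _ = (12 * M ^ 3 + 6 * M ^ 2) * r ^ 3 * D := by ring
    _ ≤ 18 * M ^ 3 * r ^ 3 * D := by
        gcongr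
        nlinarith [mul_nonneg (sq_nonneg M) (sub_nonneg.2 hM)]

end Incr

/-- Forward bounds of constant order for a path and its second order process. -/
structure RoughBound {d : ℕ} (T a K : ℝ) (X : ℝ → Vec d) (XX : ℝ → ℝ → SqMat d) : Prop where
  one_le : 1 ≤ K
  fst : ∀ s t, 0 ≤ s → s ≤ t → t ≤ T → t - s ≤ 1 → ‖X t - X s‖ ≤ K * (t - s) ^ a
  snd : ∀ s t, 0 ≤ s → s ≤ t → t ≤ T → t - s ≤ 1 → ‖XX s t‖ ≤ K * (t - s) ^ (2 * a)
  chen : ∀ s ∈ Set.Icc 0 T, ∀ u ∈ Set.Icc 0 T, ∀ t ∈ Set.Icc 0 T, s ≤ u → u ≤ t →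
    ∀ i j : Fin d, (XX s t - XX s u - XX u t) (i, j) = (X u - X s) i * (X t - X u) j

/-- The increments of the second order scheme along `(X, 𝕏)`. -/
def rdeIncr {d n : ℕ} (f : Vec n → LinVec d n) (X : ℝ → Vec d) (XX : ℝ → ℝ → SqMat d)
    (s t : ℝ) (y : Vec n) : Vec n :=
  incr f (X t - X s) (XX s t) y

variable {d n : ℕ} {f : Vec n → LinVec d n} {X : ℝ → Vec d} {XX : ℝ → ℝ → SqMat d}
  {T a K M : ℝ}

/-- With `r = K (t-s)^a`, first-order data are at most `r` and, as `K ≥ 1`, second-order data at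
most `r²`. The defect is cubic in `r`, hence of order `3a > 1`; `δ` ensures `r ≤ 1`. -/
lemma RoughBound.exists_almostFlow (hX : RoughBound T a K X XX) (ha : 1 / 3 < a)
    (hf : FieldBound M f) (hM : 1 ≤ M) :
    ∃ δ L, AlmostFlow T δ a (3 * a) L (rdeIncr f X XX) := by
  obtain ⟨δ, hδ, hδ1, hsmall⟩ := exists_small_scale (δ := 1) (a := a) (L := K) (ε := 1)
    one_pos (by linarith) one_pos
  have hK := hX.one_le
  have hrK : ∀ h : ℝ, 0 ≤ h → K * h ^ (2 * a) ≤ (K * h ^ a) ^ 2 := by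
    intro h hh
    rw [mul_comm 2 a, Real.rpow_mul hh, Real.rpow_two, mul_pow]
    gcongr
    nlinarith
  have h3 : ∀ h : ℝ, 0 ≤ h → 18 * M ^ 3 * (K * h ^ a) ^ 3 = 18 * M ^ 3 * K ^ 3 * h ^ (3 * a) := by
    intro h hh
    rw [mul_comm 3 a, Real.rpow_mul hh, mul_pow]
    norm_cast
    ring
  have b : ∀ s v w t, 0 ≤ s → s ≤ v → v ≤ w → w ≤ t → t ≤ T → t - s ≤ δ →
      ‖X w - X v‖ ≤ K * (t - s) ^ a ∧ ‖XX v w‖ ≤ (K * (t - s) ^ a) ^ 2 := by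
    intro s v w t hs hsv hvw hwt ht hd
    have h0 : 0 ≤ w - v := by linarith
    refine ⟨(hX.fst v w (by linarith) hvw (by linarith) (by linarith)).trans (by gcongr), ?_⟩
    refine ((hX.snd v w (by linarith) hvw (by linarith) (by linarith)).trans (hrK _ h0)).trans ?_
    gcongr
  have hL : 2 * M * K ≤ 18 * M ^ 3 * K ^ 3 := by
    have h1 : M ≤ M ^ 3 := le_self_pow₀ hM (by norm_num)
    have h2 : K ≤ K ^ 3 := le_self_pow₀ hK (by norm_num)
    calc 2 * M * K ≤ 18 * M * K := by gcongr; norm_num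
      _ ≤ _ := by gcongr
  have hM0 : 0 ≤ M := by linarith
  refine ⟨δ, 18 * M ^ 3 * K ^ 3, hδ, hδ1, by linarith, by linarith, by positivity,
    fun s t hs hst ht hd y => ?_, fun s t hs hst ht hd y z => ?_,
    fun s t hs hst ht hd y z w => ?_, fun s u t hs hsu hut ht hd y => ?_,
    fun s u t hs hsu hut ht hd y z => ?_⟩
  · have h0 : 0 ≤ t - s := by linarith
    obtain ⟨b1, b2⟩ := b s s t t hs le_rfl hst le_rfl ht hd
    refine (hf.norm_incr_le b1 b2 (hsmall _ h0 hd) y).trans ?_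
    rw [← mul_assoc]; gcongr
  · have h0 : 0 ≤ t - s := by linarith
    obtain ⟨b1, b2⟩ := b s s t t hs le_rfl hst le_rfl ht hd
    refine (hf.norm_incr_sub_le b1 b2 (hsmall _ h0 hd) y z).trans ?_
    rw [← mul_assoc]; gcongr
  · have h0 : 0 ≤ t - s := by linarith
    obtain ⟨b1, b2⟩ := b s s t t hs le_rfl hst le_rfl ht hd
    refine (hf.norm_incr_incr_le b1 b2 (hsmall _ h0 hd) y z w).trans ?_
    rw [← mul_assoc]; gcongr
  · have h0 : 0 ≤ t - s := by linarith
    obtain ⟨b1, b2⟩ := b s s u t hs le_rfl hsu hut ht hd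
    obtain ⟨b1', b2'⟩ := b s u t t hs hsu hut le_rfl ht hd
    rw [← h3 _ h0]
    exact hf.norm_incr_flow_defect_le hM (by abel) (hX.chen s ⟨hs, by linarith⟩ u
      ⟨by linarith, by linarith⟩ t ⟨by linarith, ht⟩ hsu hut) (hsmall _ h0 hd) b1 b1' b2 b2' y
  · have h0 : 0 ≤ t - s := by linarith
    obtain ⟨b1, b2⟩ := b s s u t hs le_rfl hsu hut ht hd
    obtain ⟨b1', b2'⟩ := b s u t t hs hsu hut le_rfl ht hd
    rw [← h3 _ h0]
    exact hf.norm_incr_flow_defect_sub_le hM (by abel) (hX.chen s ⟨hs, by linarith⟩ u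
      ⟨by linarith, by linarith⟩ t ⟨by linarith, ht⟩ hsu hut) (hsmall _ h0 hd) b1 b1' b2 b2' y z

lemma tendsto_zero_of_norm_le_rpow {E : Type*} [NormedAddCommGroup E] {U : Filter ℕ}
    {g : ℕ → E} {h : ℕ → ℝ} {a K : ℝ} (ha : 0 < a) (hh : Tendsto h U (𝓝 0))
    (hg : ∀ᶠ m in U, ‖g m‖ ≤ K * h m ^ a) : Tendsto g U (𝓝 0) := by
  refine squeeze_zero_norm' hg ?_
  have := (hh.rpow_const (p := a) (Or.inr ha.le)).const_mul K
  simpa [Real.zero_rpow ha.ne'] using this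

lemma tendsto_euclidean_iff {ι : Type*} [Fintype ι] {U : Filter ℕ} {g : ℕ → EuclideanSpace ℝ ι}
    {v : EuclideanSpace ℝ ι} :
    Tendsto g U (𝓝 v) ↔ ∀ i, Tendsto (fun m => g m i) U (𝓝 (v i)) := by
  constructor
  · intro h i
    exact ((PiLp.continuous_apply 2 (fun _ : ι => ℝ) i).tendsto v).comp h
  · intro h
    exact ((PiLp.continuous_toLp 2 (fun _ : ι => ℝ)).tendsto _).comp (tendsto_pi_nhds.2 h)

/-- Chen's relation expands `𝕏_{σ,t}` both through `s` and through `ρ`. Equating the two expresses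
`𝕏_{σ,ρ}` as `𝕏_{s,t}` plus terms over the shrinking intervals `[σ,s]` and `[ρ,t]`. -/
lemma RoughBound.tendsto_snd (hX : RoughBound T a K X XX) (ha : 0 < a) {U : Filter ℕ}
    {σ ρ : ℕ → ℝ} {s t : ℝ} (hst : s ≤ t) (ht : t ≤ T)
    (hev : ∀ᶠ m in U, 0 ≤ σ m ∧ σ m ≤ s ∧ s ≤ ρ m ∧ ρ m ≤ t) (hσ : Tendsto σ U (𝓝 s))
    (hρ : Tendsto ρ U (𝓝 t)) :
    Tendsto (fun m => X (ρ m) - X (σ m)) U (𝓝 (X t - X s)) ∧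
      Tendsto (fun m => XX (σ m) (ρ m)) U (𝓝 (XX s t)) := by
  have hσ' : Tendsto (fun m => s - σ m) U (𝓝 0) := by simpa using hσ.const_sub s
  have hρ' : Tendsto (fun m => t - ρ m) U (𝓝 0) := by simpa using hρ.const_sub t
  have eσ := hσ'.eventually (ge_mem_nhds one_pos)
  have eρ := hρ'.eventually (ge_mem_nhds one_pos)
  have x1 : Tendsto (fun m => X s - X (σ m)) U (𝓝 0) := by
    refine tendsto_zero_of_norm_le_rpow (K := K) ha hσ' ?_
    filter_upwards [hev, eσ] with m ⟨h1, h2, h3, h4⟩ h5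
    exact hX.fst _ _ h1 h2 (hst.trans ht) h5
  have x2 : Tendsto (fun m => X t - X (ρ m)) U (𝓝 0) := by
    refine tendsto_zero_of_norm_le_rpow (K := K) ha hρ' ?_
    filter_upwards [hev, eρ] with m ⟨h1, h2, h3, h4⟩ h5
    exact hX.fst _ _ (by linarith) h4 ht h5
  have x3 : Tendsto (fun m => X (ρ m) - X (σ m)) U (𝓝 (X t - X s)) := by
    have := (x1.sub x2).add_const (X t - X s)
    rw [sub_zero, zero_add] at this
    exact this.congr fun m => by abel
  have y1 : Tendsto (fun m => XX (σ m) s) U (𝓝 0) := by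
    refine tendsto_zero_of_norm_le_rpow (K := K) (a := 2 * a) (by positivity) hσ' ?_
    filter_upwards [hev, eσ] with m ⟨h1, h2, h3, h4⟩ h5
    exact hX.snd _ _ h1 h2 (hst.trans ht) h5
  have y2 : Tendsto (fun m => XX (ρ m) t) U (𝓝 0) := by
    refine tendsto_zero_of_norm_le_rpow (K := K) (a := 2 * a) (by positivity) hρ' ?_
    filter_upwards [hev, eρ] with m ⟨h1, h2, h3, h4⟩ h5
    exact hX.snd _ _ (by linarith) h4 ht h5
  refine ⟨x3, tendsto_euclidean_iff.2 ?_⟩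
  rintro ⟨i, j⟩
  have c1 := tendsto_euclidean_iff.1 y1 (i, j)
  have c2 := tendsto_euclidean_iff.1 y2 (i, j)
  have c3 := (tendsto_euclidean_iff.1 x1 i).mul_const ((X t - X s) j)
  have c4 := (tendsto_euclidean_iff.1 x3 i).mul (tendsto_euclidean_iff.1 x2 j)
  have c := ((c1.add c3).sub (c2.add c4)).add_const (XX s t (i, j))
  simp only [PiLp.zero_apply, zero_mul, mul_zero, add_zero, sub_zero, zero_add] at c
  refine c.congr' ?_
  filter_upwards [hev] with m ⟨h1, h2, h3, h4⟩
  have k1 := hX.chen (σ m) ⟨h1, by linarith⟩ s ⟨by linarith, by linarith⟩ t ⟨by linarith, ht⟩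
    h2 hst i j
  have k2 := hX.chen (σ m) ⟨h1, by linarith⟩ (ρ m) ⟨by linarith, by linarith⟩ t
    ⟨by linarith, ht⟩ (by linarith) h4 i j
  simp only [PiLp.sub_apply] at k1 k2 ⊢
  linarith

lemma RoughBound.tendsto_rdeIncr (hX : RoughBound T a K X XX) (ha : 0 < a)
    (hf : FieldBound M f) {U : Filter ℕ}
    {σ ρ : ℕ → ℝ} {z : ℕ → Vec n} {s t : ℝ} {y : Vec n} (hst : s ≤ t) (ht : t ≤ T)
    (hev : ∀ᶠ m in U, 0 ≤ σ m ∧ σ m ≤ s ∧ s ≤ ρ m ∧ ρ m ≤ t) (hσ : Tendsto σ U (𝓝 s))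
    (hρ : Tendsto ρ U (𝓝 t)) (hz : Tendsto z U (𝓝 y)) :
    Tendsto (fun m => rdeIncr f X XX (σ m) (ρ m) (z m)) U (𝓝 (rdeIncr f X XX s t y)) := by
  obtain ⟨h1, h2⟩ := hX.tendsto_snd ha hst ht hev hσ hρ
  have hlip : ∀ {F : Type} [NormedAddCommGroup F] {g : Vec n → F}, HasLipIncr M g →
      Tendsto (fun m => g (z m)) U (𝓝 (g y)) := by
    intro F _ g hg
    have : LipschitzWith M.toNNReal g := LipschitzWith.of_dist_le_mul fun x y => by
      rw [dist_eq_norm, dist_eq_norm, Real.coe_toNNReal _ hg.nonneg]; exact hg.lip x y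
    exact (this.continuous.tendsto y).comp hz
  have hb1 : Continuous fun p : LinVec d n × Vec d => p.1 p.2 :=
    continuous_fst.clm_apply continuous_snd
  have hb2 : Continuous fun p : (SqMat d →L[ℝ] Vec n) × SqMat d => p.1 p.2 :=
    continuous_fst.clm_apply continuous_snd
  exact ((hb1.tendsto _).comp ((hlip hf.fst).prodMk_nhds h1)).add
    ((hb2.tendsto _).comp ((hlip hf.snd).prodMk_nhds h2))

/-! ### Riemann limits -/

/-- The increments of `Y` telescope, and the errors sum to at most `C t` times the `(θ - 1)`-th
power of the mesh. -/
lemma isRiemannLimit_of_increments {E : Type*} [NormedAddCommGroup E] {Ξ : ℝ → ℝ → E} {Y : ℝ → E}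
    {T δ θ C : ℝ} (hθ : 1 < θ) (hC : 0 ≤ C) (hδ : 0 < δ)
    (h : ∀ s t, 0 ≤ s → s ≤ t → t ≤ T → t - s ≤ δ → ‖Y t - Y s - Ξ s t‖ ≤ C * (t - s) ^ θ)
    {t : ℝ} (ht : t ∈ Set.Icc 0 T) : IsRiemannLimit Ξ 0 t (Y t - Y 0) := by
  intro ε hε
  obtain ⟨δ', hδ', hδδ, hsmall⟩ := exists_small_scale (L := C * t) (a := θ - 1) (ε := ε / 2)
    hδ (by linarith) (by positivity)
  refine ⟨δ', hδ', fun N p hp h0 hN hmesh => ?_⟩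
  have hp0 : ∀ i, 0 ≤ p i := fun i => h0 ▸ hp (Nat.zero_le i)
  have hpN : ∀ i ≤ N, p i ≤ t := fun i hi => hN ▸ hp hi
  have e : (∑ i ∈ Finset.range N, Ξ (p i) (p (i + 1))) - (Y t - Y 0) =
      -∑ i ∈ Finset.range N, (Y (p (i + 1)) - Y (p i) - Ξ (p i) (p (i + 1))) := by
    rw [Finset.sum_sub_distrib, Finset.sum_range_sub (fun i => Y (p i)), h0, hN]; abel
  rw [e, norm_neg]
  calc _ ≤ ∑ i ∈ Finset.range N, C * δ' ^ (θ - 1) * (p (i + 1) - p i) := by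
        refine (norm_sum_le _ _).trans (Finset.sum_le_sum fun i hi => ?_)
        have hiN := Finset.mem_range.1 hi
        have h1 := hmesh i hiN
        have h2 : p i ≤ p (i + 1) := hp (Nat.le_succ i)
        refine (h _ _ (hp0 i) h2 ((hpN _ hiN).trans ht.2) (by linarith)).trans ?_
        rw [mul_assoc]
        gcongr
        exact rpow_le_mul_of_le (by linarith) h1.le hθ
    _ = C * t * δ' ^ (θ - 1) := by
        rw [← Finset.mul_sum, Finset.sum_range_sub p, h0, hN]; ring
    _ ≤ ε / 2 := hsmall δ' hδ'.le le_rfl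
    _ < ε := by linarith

/-- The limits are given only over `[0,t]`. A partition of `[0,s]` followed by one of `[s,t]`
partitions `[0,t]`; subtracting the sum over `[0,s]` leaves the sum over `[s,t]`. -/
lemma tendsto_uniformSum_of_isRiemannLimit {E : Type*} [NormedAddCommGroup E] {Ξ : ℝ → ℝ → E}
    {Y : ℝ → E} {y : E} {T : ℝ} (h : ∀ t ∈ Set.Icc 0 T, IsRiemannLimit Ξ 0 t (Y t - y))
    {s t : ℝ} (hs : 0 ≤ s) (hst : s ≤ t) (ht : t ≤ T) :
    Tendsto (uniformSum (fun s t => Y t - Y s - Ξ s t) s t) atTop (𝓝 0) := by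
  rw [Metric.tendsto_atTop]
  intro ε hε
  obtain ⟨δ₁, hδ₁, h1⟩ := h s ⟨hs, hst.trans ht⟩ (ε / 2) (by positivity)
  obtain ⟨δ₂, hδ₂, h2⟩ := h t ⟨hs.trans hst, ht⟩ (ε / 2) (by positivity)
  have hmin : 0 < min δ₁ δ₂ := lt_min hδ₁ hδ₂
  obtain ⟨N₀, hN₀⟩ := exists_nat_gt (t / min δ₁ δ₂)
  refine ⟨N₀ + 1, fun N hN => ?_⟩
  have hN0 : (0 : ℝ) < N := by exact_mod_cast (by omega : 0 < N)
  have hNt : t < N * min δ₁ δ₂ := by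
    rw [div_lt_iff₀ hmin] at hN₀
    refine hN₀.trans_le ?_
    gcongr
    exact_mod_cast (by omega : N₀ ≤ N)
  have hlt : ∀ v, v ≤ t → v / N < min δ₁ δ₂ := fun v hv => by
    rw [div_lt_iff₀ hN0]; linarith
  have hs' : 0 ≤ s / N := by positivity
  have ht' : 0 ≤ (t - s) / N := div_nonneg (by linarith) hN0.le
  set q : ℕ → ℝ := fun i => i * (s / N) with hq
  set q' : ℕ → ℝ := fun i => s + i * ((t - s) / N) with hq'
  -- The concatenation in one formula: `min i N` stops the first partition at `s`, and the truncated
  -- difference `i - N` starts the second one there.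
  set p : ℕ → ℝ := fun i => (min i N : ℕ) * (s / N) + (i - N : ℕ) * ((t - s) / N) with hp
  have hpq : ∀ i ≤ N, p i = q i := fun i hi => by
    simp only [hp, hq, min_eq_left hi, Nat.sub_eq_zero_of_le hi, Nat.cast_zero, zero_mul, add_zero]
  have hpq' : ∀ i, p (N + i) = q' i := fun i => by
    simp only [hp, hq', min_eq_right (Nat.le_add_right N i), Nat.add_sub_cancel_left]
    field_simp
  have hqN : q N = s := by simp only [hq]; field_simp
  have hqN' : q' N = t := by simp only [hq']; field_simp; ring
  have S1 := h1 N q (fun i j hij => by simp only [hq]; gcongr) (by simp [hq]) hqN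
    (fun i _ => by
      have : q (i + 1) - q i = s / N := by simp only [hq]; push_cast; ring
      rw [this]; exact (hlt s hst).trans_le (min_le_left _ _))
  have S2 := h2 (N + N) p (fun i j hij => by
      simp only [hp]
      have k1 : ((min i N : ℕ) : ℝ) ≤ (min j N : ℕ) := by exact_mod_cast (by omega)
      have k2 : ((i - N : ℕ) : ℝ) ≤ (j - N : ℕ) := by exact_mod_cast (by omega)
      gcongr) (by simp [hp]) (by rw [hpq', hqN'])
    (fun i _ => by
      rcases Nat.lt_or_ge i N with hi | hi
      · rw [hpq i hi.le, hpq (i + 1) hi]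
        have : q (i + 1) - q i = s / N := by simp only [hq]; push_cast; ring
        rw [this]; exact (hlt s hst).trans_le (min_le_right _ _)
      · obtain ⟨k, rfl⟩ := Nat.exists_eq_add_of_le hi
        rw [add_assoc, hpq', hpq']
        have : q' (k + 1) - q' k = (t - s) / N := by simp only [hq']; push_cast; ring
        rw [this]; exact (hlt _ (by linarith)).trans_le (min_le_right _ _))
  have e1 : ∑ i ∈ Finset.range (N + N), Ξ (p i) (p (i + 1)) =
      ∑ i ∈ Finset.range N, Ξ (q i) (q (i + 1)) +
      ∑ i ∈ Finset.range N, Ξ (q' i) (q' (i + 1)) := by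
    rw [Finset.sum_range_add]
    congr 1
    · refine Finset.sum_congr rfl fun i hi => ?_
      have := Finset.mem_range.1 hi
      rw [hpq i this.le, hpq (i + 1) this]
    · refine Finset.sum_congr rfl fun i _ => ?_
      rw [add_assoc, hpq', hpq']
  have e2 : uniformSum (fun s t => Y t - Y s - Ξ s t) s t N =
      (Y t - Y s) - ∑ i ∈ Finset.range N, Ξ (q' i) (q' (i + 1)) := by
    have hz : q' 0 = s := by simp [hq']
    rw [uniformSum, Finset.sum_sub_distrib, Finset.sum_range_sub (fun i => Y (q' i)), hqN', hz]
  rw [e1] at S2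
  rw [dist_zero_right, e2]
  set A := ∑ i ∈ Finset.range N, Ξ (q i) (q (i + 1))
  set B := ∑ i ∈ Finset.range N, Ξ (q' i) (q' (i + 1))
  have e3 : Y t - Y s - B = (A - (Y s - y)) - (A + B - (Y t - y)) := by abel
  rw [e3]
  exact (norm_sub_le _ _).trans_lt (by linarith)

/-! ### Solutions and the almost flow -/

section RDE

variable {d n : ℕ} {f : Vec n → LinVec d n} {X : ℝ → Vec d} {XX : ℝ → ℝ → SqMat d}
  {T M : ℝ} {α : ℝ → ℝ}

lemma one_lt_min_add {a : ℝ} (ha : 1 / 3 < a) : 1 < min (2 * a) 1 + a := by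
  rcases min_cases (2 * a) 1 with h | h <;> linarith

/-- Local error of a solution on an interval where all data have order `a`. -/
lemma norm_error_le (hf : FieldBound M f)
    (hchen : ∀ s ∈ Set.Icc 0 T, ∀ u ∈ Set.Icc 0 T, ∀ t ∈ Set.Icc 0 T, s ≤ u → u ≤ t →
      ∀ i j : Fin d, (XX s t - XX s u - XX u t) (i, j) = (X u - X s) i * (X t - X u) j)
    {Z : ℝ → Vec n} {y : Vec n}
    (hZ : ∀ t ∈ Set.Icc 0 T, IsRiemannLimit (fun s t => rdeIncr f X XX s t (Z s)) 0 t (Z t - y))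
    {s t a₀ a B : ℝ} (hs : 0 ≤ s) (hst : s ≤ t) (ht : t ≤ T) (hd : t - s ≤ 1)
    (ha₀ : 1 / 3 < a₀) (ha : a₀ ≤ a) (hB : 0 ≤ B)
    (bX : ∀ u v, s ≤ u → u ≤ v → v ≤ t → ‖X v - X u‖ ≤ B * (v - u) ^ a)
    (bXX : ∀ u v, s ≤ u → u ≤ v → v ≤ t → ‖XX u v‖ ≤ B * (v - u) ^ (2 * a))
    (bZ : ∀ u v, s ≤ u → u ≤ v → v ≤ t → ‖Z v - Z u‖ ≤ B * (v - u) ^ a)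
    (bR : ∀ u v, s ≤ u → u ≤ v → v ≤ t →
      ‖Z v - Z u - f (Z u) (X v - X u)‖ ≤ B * (v - u) ^ min (2 * a) 1) :
    ‖Z t - Z s - rdeIncr f X XX s t (Z s)‖ ≤
      (M * (B ^ 2 + B) * B + M * B * B) / (1 - (2 / 3 : ℝ) ^ (min (2 * a₀) 1 + a₀ - 1)) *
        (t - s) ^ (min (2 * a) 1 + a) := by
  have hM := hf.nonneg
  have ha' : 0 < a := by linarith
  refine sewing_bound (Ξ := fun s t => Z t - Z s - rdeIncr f X XX s t (Z s)) hst (by positivity)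
    (one_lt_min_add ha₀) (by gcongr) ?_ (tendsto_uniformSum_of_isRiemannLimit hZ hs hst ht)
  intro v u w hv hvu huw hw
  -- The increments of `Z` are additive and drop out, so the defect of the error is that of the
  -- scheme, evaluated at the points `Z v` and `Z u`.
  have e : (Z w - Z v - rdeIncr f X XX v w (Z v)) - (Z u - Z v - rdeIncr f X XX v u (Z v)) -
      (Z w - Z u - rdeIncr f X XX u w (Z u)) = rdeIncr f X XX v u (Z v) +
      rdeIncr f X XX u w (Z u) - rdeIncr f X XX v w (Z v) := by abel
  rw [e]
  have h0 : 0 ≤ w - v := by linarith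
  have h1 : w - v ≤ 1 := by linarith
  have hvu0 : 0 ≤ u - v := by linarith
  have huw0 : 0 ≤ w - u := by linarith
  set h := w - v with hh
  have c1 : ‖X w - X u‖ ≤ B * h ^ a := (bX u w (by linarith) huw hw).trans (by gcongr; linarith)
  have c2 : ‖XX u w‖ ≤ B * h ^ (2 * a) :=
    (bXX u w (by linarith) huw hw).trans (by gcongr; linarith)
  have c3 : ‖Z u - Z v‖ ≤ B * h ^ a := (bZ v u hv hvu (by linarith)).trans (by gcongr; linarith)
  have hm0 : 0 ≤ min (2 * a) 1 := le_min (by linarith) zero_le_one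
  have c4 : ‖Z u - Z v - f (Z v) (X u - X v)‖ ≤ B * h ^ min (2 * a) 1 :=
    (bR v u hv hvu (by linarith)).trans (by gcongr; linarith)
  have p1 : (h ^ a) ^ 2 = h ^ (2 * a) := by
    rw [mul_comm 2 a, Real.rpow_mul h0, Real.rpow_two]
  have p2 : h ^ (2 * a) ≤ h ^ min (2 * a) 1 :=
    Real.rpow_le_rpow_of_exponent_ge' h0 h1 hm0 (min_le_left _ _)
  have p3 : h ^ (min (2 * a) 1 + a) = h ^ min (2 * a) 1 * h ^ a :=
    Real.rpow_add_of_nonneg h0 hm0 ha'.le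
  refine (hf.norm_incr_defect_le (by abel) (hchen v ⟨by linarith, by linarith⟩ u
    ⟨by linarith, by linarith⟩ w ⟨by linarith, by linarith⟩ hvu huw) (Z v) (Z u)).trans ?_
  have q1 : 0 ≤ h ^ a := Real.rpow_nonneg h0 _
  have q2 : 0 ≤ h ^ min (2 * a) 1 := Real.rpow_nonneg h0 _
  calc _ ≤ M * ((B * h ^ a) ^ 2 + B * h ^ min (2 * a) 1) * (B * h ^ a) +
        M * (B * h ^ a) * (B * h ^ (2 * a)) := by gcongr
    _ = M * (B ^ 2 * h ^ (2 * a) + B * h ^ min (2 * a) 1) * (B * h ^ a) +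
        M * (B * h ^ a) * (B * h ^ (2 * a)) := by rw [mul_pow, p1]
    _ ≤ M * (B ^ 2 * h ^ min (2 * a) 1 + B * h ^ min (2 * a) 1) * (B * h ^ a) +
        M * (B * h ^ a) * (B * h ^ min (2 * a) 1) := by gcongr
    _ = _ := by rw [p3]; ring

lemma IsHolderTwo.exists_nonneg {E : Type*} [NormedAddCommGroup E] {β : ℝ → ℝ} {g : ℝ → ℝ → E}
    (h : IsHolderTwo T β g) : ∃ C, 0 ≤ C ∧ ∀ s ∈ Set.Icc 0 T, ∀ t ∈ Set.Icc 0 T, |t - s| ≤ 1 →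
      ‖g s t‖ ≤ C * |t - s| ^ (β s) := by
  obtain ⟨C, hC⟩ := h
  exact ⟨max C 0, le_max_right _ _, fun s hs t ht hst => (hC s hs t ht hst).trans (by
    gcongr; exact le_max_left _ _)⟩

lemma abs_rpow_anti {x p q : ℝ} (hx : |x| ≤ 1) (hp : 0 ≤ p) (hpq : p ≤ q) :
    |x| ^ q ≤ |x| ^ p :=
  Real.rpow_le_rpow_of_exponent_ge' (abs_nonneg _) hx hp hpq

lemma forward_bound {E : Type*} [NormedAddCommGroup E] {g : ℝ → ℝ → E} {β : ℝ → ℝ} {b C B : ℝ}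
    (hC : 0 ≤ C) (hCB : C ≤ B)
    (hg : ∀ s ∈ Set.Icc 0 T, ∀ t ∈ Set.Icc 0 T, |t - s| ≤ 1 → ‖g s t‖ ≤ C * |t - s| ^ (β s))
    {u v : ℝ} (hu : 0 ≤ u) (huv : u ≤ v) (hv : v ≤ T) (hd : v - u ≤ 1) (hb : 0 ≤ b)
    (hbβ : b ≤ β u) : ‖g u v‖ ≤ B * (v - u) ^ b := by
  have habs : |v - u| = v - u := abs_of_nonneg (by linarith)
  have h3 := hg u ⟨hu, by linarith⟩ v ⟨by linarith, hv⟩ (by rwa [habs])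
  have h4 := abs_rpow_anti (x := v - u) (by rwa [habs]) hb hbβ
  rw [habs] at h3 h4
  have hB : 0 ≤ B := hC.trans hCB
  have : 0 ≤ (v - u) ^ b := Real.rpow_nonneg (by linarith) _
  exact h3.trans (by gcongr)

lemma IsRoughPath.exists_roughBound (hX : IsRoughPath T α X XX) {a : ℝ} (ha0 : 0 ≤ a)
    (ha : ∀ t ∈ Set.Icc 0 T, a ≤ α t) (ha1 : a ≤ 1 / 2) : ∃ K, RoughBound T a K X XX := by
  obtain ⟨C₁, h1, hC₁⟩ := hX.holder_fst.exists_nonneg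
  obtain ⟨C₂, h2, hC₂⟩ := hX.holder_snd.exists_nonneg
  refine ⟨C₁ + C₂ + 1, by linarith, fun s t hs hst ht hd => ?_, fun s t hs hst ht hd => ?_, hX.chen⟩
  · exact forward_bound (g := fun s t => X t - X s) h1 (by linarith) hC₁ hs hst ht hd ha0
      (ha s ⟨hs, hst.trans ht⟩)
  · refine forward_bound h2 (by linarith) hC₂ hs hst ht hd (by linarith) (le_min ?_ (by linarith))
    linarith [ha s ⟨hs, hst.trans ht⟩]

lemma IsRDESolution.isRiemannLimit {y : Vec n} {Y : ℝ → Vec n} {Y' : ℝ → LinVec d n}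
    (h : IsRDESolution T α X XX f y Y Y') {t : ℝ} (ht : t ∈ Set.Icc 0 T) :
    IsRiemannLimit (fun s t => rdeIncr f X XX s t (Y s)) 0 t (Y t - y) := by
  intro ε hε
  obtain ⟨δ, hδ, H⟩ := h.integral_eq t ht ε hε
  refine ⟨δ, hδ, fun N p hp h0 hN hm => ?_⟩
  have e : ∑ i ∈ Finset.range N, rdeIncr f X XX (p i) (p (i + 1)) (Y (p i)) =
      ∑ i ∈ Finset.range N, germ X XX (fun r => f (Y r))
        (fun r => (fderiv ℝ f (Y r)).comp (Y' r)) (p i) (p (i + 1)) := by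
    refine Finset.sum_congr rfl fun i hi => ?_
    have hi' := Finset.mem_range.1 hi
    have hpi : p i ∈ Set.Icc 0 T :=
      ⟨h0 ▸ hp (Nat.zero_le i), (hN ▸ hp hi'.le : p i ≤ t).trans ht.2⟩
    simp only [germ, h.deriv_eq _ hpi]
    rfl
  rw [e]
  exact H N p hp h0 hN hm

/-- A solution has order `α` as a path. -/
lemma IsRDESolution.isHolder (h0α : ∀ t ∈ Set.Icc 0 T, α t ∈ Set.Ioo (1 / 3 : ℝ) 1)
    (hX : IsRoughPath T α X XX) (hf : FieldBound M f)
    {y : Vec n} {Y : ℝ → Vec n} {Y' : ℝ → LinVec d n} (h : IsRDESolution T α X XX f y Y Y') :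
    IsHolder T α Y := by
  obtain ⟨C₁, h1, hC₁⟩ := hX.holder_fst.exists_nonneg
  obtain ⟨C₂, h2, hC₂⟩ := h.controlled.holder_remainder.exists_nonneg
  have hM := hf.nonneg
  refine ⟨C₂ + M * C₁, fun s hs t ht hst => ?_⟩
  have b1 := hC₁ s hs t ht hst
  have b2 := hC₂ s hs t ht hst
  obtain ⟨hα1, hα2⟩ := h0α s hs
  have b3 := abs_rpow_anti hst (by linarith : 0 ≤ α s)
    (le_min (by linarith) hα2.le : α s ≤ min (2 * α s) 1)
  have e : Y t - Y s = remainder X Y Y' s t + f (Y s) (X t - X s) := by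
    simp [remainder, h.deriv_eq s hs]
  dsimp only
  rw [e, add_mul]
  refine (norm_add_le _ _).trans (add_le_add (b2.trans (by gcongr)) ?_)
  rw [mul_assoc]
  exact (ContinuousLinearMap.le_opNorm _ _).trans
    (mul_le_mul (hf.fst.bound _) b1 (norm_nonneg _) hM)

lemma Follows.mono {E : Type*} [NormedAddCommGroup E] {ψ : ℝ → ℝ → E → E} {Y : ℝ → E}
    {δ δ' θ C C' : ℝ} (h : Follows T δ θ C ψ Y) (hδ : δ' ≤ δ) (hC : C ≤ C') :
    Follows T δ' θ C' ψ Y := fun s t hs hst ht hd =>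
  (h s t hs hst ht (hd.trans hδ)).trans (by
    have : 0 ≤ (t - s) ^ θ := Real.rpow_nonneg (by linarith) _
    gcongr)

lemma AlmostFlow.mono {E : Type*} [NormedAddCommGroup E] {ψ : ℝ → ℝ → E → E}
    {δ δ' a θ L : ℝ} (H : AlmostFlow T δ a θ L ψ) (h0 : 0 < δ') (hδ : δ' ≤ δ) :
    AlmostFlow T δ' a θ L ψ where
  δ_pos := h0
  δ_le := hδ.trans H.δ_le
  a_pos := H.a_pos
  one_lt := H.one_lt
  L_nonneg := H.L_nonneg
  bound s t hs hst ht hd := H.bound s t hs hst ht (hd.trans hδ)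
  lip s t hs hst ht hd := H.lip s t hs hst ht (hd.trans hδ)
  incr s t hs hst ht hd := H.incr s t hs hst ht (hd.trans hδ)
  defect s u t hs hsu hut ht hd := H.defect s u t hs hsu hut ht (hd.trans hδ)
  defect_lip s u t hs hsu hut ht hd := H.defect_lip s u t hs hsu hut ht (hd.trans hδ)

/-- A solution follows the almost flow of the equation. -/
lemma IsRDESolution.exists_follows (h0α : ∀ t ∈ Set.Icc 0 T, α t ∈ Set.Ioo (1 / 3 : ℝ) 1)
    (hX : IsRoughPath T α X XX) (hf : FieldBound M f) {a : ℝ} (ha0 : 1 / 3 < a)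
    (ha : ∀ t ∈ Set.Icc 0 T, a ≤ α t) (ha1 : a ≤ 1 / 2)
    {y : Vec n} {Y : ℝ → Vec n} {Y' : ℝ → LinVec d n} (h : IsRDESolution T α X XX f y Y Y') :
    ∃ C, 0 ≤ C ∧ Follows T 1 (3 * a) C (rdeIncr f X XX) Y := by
  obtain ⟨K, hK⟩ := hX.exists_roughBound (by linarith) ha ha1
  obtain ⟨C₁, h1, hC₁⟩ := (h.isHolder h0α hX hf).exists_nonneg
  obtain ⟨C₂, h2, hC₂⟩ := h.controlled.holder_remainder.exists_nonneg
  have hM := hf.nonneg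
  have hK1 := hK.one_le
  -- Because `a ≤ 1/2`, the sewing order `min (2a) 1 + a` is exactly the order `3a` of the almost
  -- flow.
  have hmin : min (2 * a) 1 = 2 * a := min_eq_left (by linarith)
  have hden : 0 < 1 - (2 / 3 : ℝ) ^ (min (2 * a) 1 + a - 1) := by
    have := two_thirds_rpow_lt_one (one_lt_min_add ha0); linarith
  refine ⟨(M * ((K + C₁ + C₂) ^ 2 + (K + C₁ + C₂)) * (K + C₁ + C₂) +
    M * (K + C₁ + C₂) * (K + C₁ + C₂)) / (1 - (2 / 3 : ℝ) ^ (min (2 * a) 1 + a - 1)),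
    by positivity, fun s t hs hst ht hd => ?_⟩
  refine (norm_error_le hf hX.chen (fun t ht => h.isRiemannLimit ht)
    hs hst ht hd ha0 le_rfl (B := K + C₁ + C₂) (by positivity) ?_ ?_ ?_ ?_).trans_eq ?_
  · intro u v hu huv hv
    have : 0 ≤ (v - u) ^ a := Real.rpow_nonneg (by linarith) _
    exact (hK.fst u v (by linarith) huv (by linarith) (by linarith)).trans (by gcongr; linarith)
  · intro u v hu huv hv
    have : 0 ≤ (v - u) ^ (2 * a) := Real.rpow_nonneg (by linarith) _
    exact (hK.snd u v (by linarith) huv (by linarith) (by linarith)).trans (by gcongr; linarith)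
  · intro u v hu huv hv
    exact forward_bound (g := fun u v => Y v - Y u) h1 (by linarith) hC₁ (by linarith) huv
      (by linarith) (by linarith) (by linarith) (ha u ⟨by linarith, by linarith⟩)
  · intro u v hu huv hv
    have hum : u ∈ Set.Icc 0 T := ⟨by linarith, by linarith⟩
    have := forward_bound (b := 2 * a) (B := K + C₁ + C₂) h2 (by linarith) hC₂ hum.1 huv
      (by linarith) (by linarith) (by linarith) (le_min (by linarith [ha u hum]) (by linarith))
    rw [hmin]
    simpa [remainder, h.deriv_eq u hum] using this
  · rw [hmin, show 2 * a + a = 3 * a by ring]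

end RDE

/-! ### Variable orders -/

section Order

variable {T : ℝ} {α β : ℝ → ℝ}

/-- The order `β` may be read off at either end point of an interval. -/
def IsComparable (T : ℝ) (β : ℝ → ℝ) : Prop :=
  ∃ C, 0 ≤ C ∧ ∀ s ∈ Set.Icc 0 T, ∀ t ∈ Set.Icc 0 T, |t - s| ≤ 1 →
    |t - s| ^ β t ≤ C * |t - s| ^ β s

lemma IsRegularityFunction.isComparable (h : IsRegularityFunction T α)
    (hpos : ∀ t ∈ Set.Icc 0 T, 0 < α t) : IsComparable T α := by
  obtain ⟨-, C, hC⟩ := h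
  refine ⟨max C 0, le_max_right _ _, fun s hs t ht hst => ?_⟩
  rcases (abs_nonneg (t - s)).eq_or_lt with h0 | h0
  · rw [← h0, Real.zero_rpow (hpos t ht).ne', Real.zero_rpow (hpos s hs).ne', mul_zero]
  · have := hC t ht s hs (by rwa [abs_sub_comm])
    rw [abs_sub_comm] at this
    calc |t - s| ^ α t = |t - s| ^ (α t - α s) * |t - s| ^ α s := by
          rw [← Real.rpow_add h0, sub_add_cancel]
      _ ≤ _ := by gcongr; exact this.trans (le_max_left _ _)

lemma IsComparable.two_mul (h : IsComparable T β) : IsComparable T (fun t => 2 * β t) := by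
  obtain ⟨C, hC0, hC⟩ := h
  refine ⟨C ^ 2, by positivity, fun s hs t ht hst => ?_⟩
  have e : ∀ b : ℝ, |t - s| ^ (2 * b) = (|t - s| ^ b) ^ 2 := fun b => by
    rw [mul_comm, Real.rpow_mul (abs_nonneg _), Real.rpow_two]
  dsimp only
  rw [e, e, ← mul_pow]
  have := hC s hs t ht hst
  gcongr

lemma IsComparable.min_one (h : IsComparable T β) (hpos : ∀ t ∈ Set.Icc 0 T, 0 < β t) :
    IsComparable T (fun t => min (β t) 1) := by
  obtain ⟨C, hC0, hC⟩ := h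
  refine ⟨max C 1, by positivity, fun s hs t ht hst => ?_⟩
  have hs0 : 0 ≤ min (β s) 1 := le_min (hpos s hs).le zero_le_one
  have hnn : 0 ≤ |t - s| ^ min (β s) 1 := by positivity
  dsimp only
  rcases le_total (β t) 1 with h1 | h1
  · rw [min_eq_left h1]
    refine (hC s hs t ht hst).trans ?_
    exact mul_le_mul (le_max_left _ _) (abs_rpow_anti hst hs0 (min_le_left _ _)) (by positivity)
      (by positivity)
  · rw [min_eq_right h1]
    refine (abs_rpow_anti hst hs0 (min_le_right _ _)).trans ?_
    exact le_mul_of_one_le_left hnn (le_max_right _ _)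

/-- Away from the diagonal boundedness suffices: for `δ < |t - s| ≤ 1` and `0 ≤ β ≤ 2` one has `|t -
s|^β ≥ δ²`. -/
lemma isHolderTwo_of_local {E : Type*} [NormedAddCommGroup E] {g : ℝ → ℝ → E}
    {δ B C C' : ℝ} (hδ : 0 < δ) (hβ : ∀ t ∈ Set.Icc 0 T, 0 ≤ β t ∧ β t ≤ 2)
    (hb : ∀ s ∈ Set.Icc 0 T, ∀ t ∈ Set.Icc 0 T, |t - s| ≤ 1 → ‖g s t‖ ≤ B)
    (hfwd : ∀ s t, 0 ≤ s → s ≤ t → t ≤ T → t - s ≤ δ → t - s ≤ 1 → ‖g s t‖ ≤ C * (t - s) ^ β s)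
    (hbwd : ∀ s t, 0 ≤ s → s ≤ t → t ≤ T → t - s ≤ δ → t - s ≤ 1 →
      ‖g t s‖ ≤ C' * (t - s) ^ β t) :
    IsHolderTwo T β g := by
  refine ⟨max (max C C') (B / δ ^ 2), fun s hs t ht hst => ?_⟩
  have hnn : 0 ≤ |t - s| ^ β s := by positivity
  rcases le_or_gt |t - s| δ with h | h
  · rcases le_total s t with hle | hle
    · have e : |t - s| = t - s := abs_of_nonneg (by linarith)
      rw [e] at h hst hnn ⊢
      refine (hfwd s t hs.1 hle ht.2 h hst).trans ?_
      gcongr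
      exact (le_max_left _ _).trans (le_max_left _ _)
    · have e : |t - s| = s - t := by rw [abs_sub_comm]; exact abs_of_nonneg (by linarith)
      rw [e] at h hst hnn ⊢
      refine (hbwd t s ht.1 hle hs.2 h hst).trans ?_
      gcongr
      exact (le_max_right _ _).trans (le_max_left _ _)
  · have hB : 0 ≤ B := (norm_nonneg _).trans (hb s hs t ht hst)
    have h1 : δ ^ 2 ≤ |t - s| ^ β s := by
      calc δ ^ 2 ≤ |t - s| ^ 2 := by gcongr
        _ = |t - s| ^ (2 : ℝ) := by norm_cast
        _ ≤ _ := abs_rpow_anti hst (hβ s hs).1 (hβ s hs).2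
    calc ‖g s t‖ ≤ B := hb s hs t ht hst
      _ = B / δ ^ 2 * δ ^ 2 := by field_simp
      _ ≤ _ := by gcongr; exact le_max_right _ _

lemma isHolder_of_forward {E : Type*} [NormedAddCommGroup E] {Y : ℝ → E}
    {δ B C : ℝ} (hδ : 0 < δ) (hC : 0 ≤ C) (hcomp : IsComparable T β)
    (hβ : ∀ t ∈ Set.Icc 0 T, 0 ≤ β t ∧ β t ≤ 2) (hb : ∀ t ∈ Set.Icc 0 T, ‖Y t‖ ≤ B)
    (hfwd : ∀ s t, 0 ≤ s → s ≤ t → t ≤ T → t - s ≤ δ → t - s ≤ 1 →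
      ‖Y t - Y s‖ ≤ C * (t - s) ^ β s) : IsHolder T β Y := by
  obtain ⟨K, hK0, hK⟩ := hcomp
  refine isHolderTwo_of_local (B := B + B) (C := C) (C' := C * K) hδ hβ
    (fun s hs t ht _ => (norm_sub_le _ _).trans (add_le_add (hb t ht) (hb s hs))) hfwd ?_
  intro s t hs hst ht hd h1
  rw [norm_sub_rev]
  refine (hfwd s t hs hst ht hd h1).trans ?_
  have e : |s - t| = t - s := by rw [abs_sub_comm]; exact abs_of_nonneg (by linarith)
  have := hK t ⟨by linarith, ht⟩ s ⟨hs, by linarith⟩ (by rwa [e])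
  rw [e] at this
  rw [mul_assoc]
  gcongr

variable {d n : ℕ} {f : Vec n → LinVec d n} {X : ℝ → Vec d} {XX : ℝ → ℝ → SqMat d} {M : ℝ}

/-- Time reversal uses `R_{t,s} = -R_{s,t} + (Y'_s - Y'_t) X_{t,s}`. The last product has order
`2α(t) ≥ β(t)`, and comparability moves the order of `R_{s,t}` from `s` to `t`. -/
lemma isHolderTwo_remainder_of_forward {Y : ℝ → Vec n} {Y' : ℝ → LinVec d n}
    (hX : IsHolder T α X) (hY' : IsHolder T α Y')
    {δ B C : ℝ} (hδ : 0 < δ) (hC : 0 ≤ C) (hcomp : IsComparable T β)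
    (hβ : ∀ t ∈ Set.Icc 0 T, 0 ≤ β t ∧ β t ≤ 2) (hβα : ∀ t ∈ Set.Icc 0 T, β t ≤ 2 * α t)
    (hb : ∀ s ∈ Set.Icc 0 T, ∀ t ∈ Set.Icc 0 T, |t - s| ≤ 1 → ‖remainder X Y Y' s t‖ ≤ B)
    (hfwd : ∀ s t, 0 ≤ s → s ≤ t → t ≤ T → t - s ≤ δ → t - s ≤ 1 →
      ‖remainder X Y Y' s t‖ ≤ C * (t - s) ^ β s) : IsHolderTwo T β (remainder X Y Y') := by
  obtain ⟨K, hK0, hK⟩ := hcomp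
  obtain ⟨C₁, h1, hC₁⟩ := IsHolderTwo.exists_nonneg hX
  obtain ⟨C₂, h2, hC₂⟩ := IsHolderTwo.exists_nonneg hY'
  refine isHolderTwo_of_local (B := B) (C := C) (C' := C * K + C₂ * C₁) hδ hβ hb hfwd ?_
  intro s t hs hst ht hd hd1
  have e : |s - t| = t - s := by rw [abs_sub_comm]; exact abs_of_nonneg (by linarith)
  have htm : t ∈ Set.Icc 0 T := ⟨by linarith, ht⟩
  have hsm : s ∈ Set.Icc 0 T := ⟨hs, by linarith⟩
  have k0 := hK t htm s hsm (by rwa [e])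
  have k1 := hC₁ t htm s hsm (by rwa [e])
  have k2 := hC₂ t htm s hsm (by rwa [e])
  have k3 := abs_rpow_anti (x := s - t) (by rwa [e]) (hβ t htm).1 (hβα t htm)
  rw [e] at k0 k1 k2 k3
  have e1 : remainder X Y Y' t s = -remainder X Y Y' s t + (Y' s - Y' t) (X s - X t) := by
    simp only [remainder, _root_.sub_apply, map_sub]; abel
  rw [e1, add_mul]
  refine (norm_add_le _ _).trans (add_le_add ?_ ?_)
  · rw [norm_neg, mul_assoc]
    exact (hfwd s t hs hst ht hd hd1).trans (by gcongr)
  · have hh : 0 ≤ t - s := by linarith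
    calc _ ≤ ‖Y' s - Y' t‖ * ‖X s - X t‖ := ContinuousLinearMap.le_opNorm _ _
      _ ≤ (C₂ * (t - s) ^ α t) * (C₁ * (t - s) ^ α t) := by
          gcongr
      _ = C₂ * C₁ * (t - s) ^ (2 * α t) := by
          rw [mul_comm 2 (α t), Real.rpow_mul hh, Real.rpow_two]; ring
      _ ≤ _ := by gcongr

lemma Follows.exists_bound {E : Type*} [NormedAddCommGroup E] {ψ : ℝ → ℝ → E → E} {Y : ℝ → E}
    {δ a θ L C : ℝ} (H : AlmostFlow T δ a θ L ψ) (hC : 0 ≤ C) (h : Follows T δ θ C ψ Y) :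
    ∃ B, ∀ t ∈ Set.Icc 0 T, ‖Y t‖ ≤ B := by
  have hL := H.L_nonneg
  have hδ := H.δ_pos
  have hk : ∀ k : ℕ, ∀ t, 0 ≤ t → t ≤ T → t ≤ k * δ → ‖Y t‖ ≤ k * (L + C) + ‖Y 0‖ := by
    intro k
    induction k with
    | zero =>
      intro t ht _ h
      have : t = 0 := le_antisymm (by simpa using h) ht
      simp [this]
    | succ k ih =>
      intro t ht hT htk
      push_cast at htk ⊢
      have hc : max 0 (t - δ) ≤ t := max_le ht (by linarith)
      have hc0 := le_max_left 0 (t - δ)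
      have hc1 := le_max_right 0 (t - δ)
      have h1 := ih _ hc0 (hc.trans hT) (max_le (by positivity) (by linarith))
      have h2 := H.norm_path_le hc0 hc hT (by linarith) hC (h _ t hc0 hc hT (by linarith))
      have h3 := norm_le_norm_sub_add (Y t) (Y (max 0 (t - δ)))
      linarith
  obtain ⟨k, hkT⟩ := exists_nat_ge (T / δ)
  rw [div_le_iff₀ hδ] at hkT
  exact ⟨_, fun t ht => hk k t ht.1 ht.2 (ht.2.trans hkT)⟩

/-- A bounded path that follows the almost flow of the equation is a solution. -/
lemma Follows.isRDESolution (hα : IsRegularityFunction T α)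
    (h0α : ∀ t ∈ Set.Icc 0 T, α t ∈ Set.Ioo (1 / 3 : ℝ) 1)
    (hX : IsRoughPath T α X XX) (hf : FieldBound M f) {Y : ℝ → Vec n} {δ θ B C : ℝ}
    (hδ : 0 < δ) (hθ : 1 < θ) (hC : 0 ≤ C) (hY : Follows T δ θ C (rdeIncr f X XX) Y)
    (hB : ∀ t ∈ Set.Icc 0 T, ‖Y t‖ ≤ B) :
    IsRDESolution T α X XX f (Y 0) Y (fun t => f (Y t)) := by
  have hM := hf.nonneg
  have hpos : ∀ t ∈ Set.Icc 0 T, 0 < α t := fun t ht => by linarith [(h0α t ht).1]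
  have hcomp := hα.isComparable hpos
  obtain ⟨C₁, h1, hC₁⟩ := IsHolderTwo.exists_nonneg hX.holder_fst
  obtain ⟨C₂, h2, hC₂⟩ := hX.holder_snd.exists_nonneg
  have hR : ∀ s t, 0 ≤ s → s ≤ t → t ≤ T → t - s ≤ δ → t - s ≤ 1 →
      ‖remainder X Y (fun t => f (Y t)) s t‖ ≤ (C + M * C₂) * (t - s) ^ min (2 * α s) 1 := by
    intro s t hs hst ht hd hd1
    have hsm : s ∈ Set.Icc 0 T := ⟨hs, by linarith⟩
    have habs : |t - s| = t - s := abs_of_nonneg (by linarith)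
    have hs3 := (h0α s hsm).1
    have k1 := hY s t hs hst ht hd
    have k2 := hC₂ s hsm t ⟨by linarith, ht⟩ (by rwa [habs])
    -- The error of order `θ > 1` is absorbed by order `2α(s) ∧ 1`, whatever the variable order;
    -- only the term with `𝕏` has to match it.
    have k3 := abs_rpow_anti (x := t - s) (by rwa [habs])
      (le_min (by linarith) zero_le_one : 0 ≤ min (2 * α s) 1)
      ((min_le_right _ _).trans hθ.le : min (2 * α s) 1 ≤ θ)
    rw [habs] at k2 k3
    have e : remainder X Y (fun t => f (Y t)) s t =
        (Y t - Y s - rdeIncr f X XX s t (Y s)) + secondField f (Y s) (XX s t) := by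
      simp only [remainder, rdeIncr, incr]; abel
    rw [e, add_mul, mul_assoc]
    refine (norm_add_le _ _).trans (add_le_add (k1.trans (by gcongr)) ?_)
    exact (ContinuousLinearMap.le_opNorm _ _).trans
      (mul_le_mul (hf.snd.bound _) k2 (norm_nonneg _) hM)
  have hYα : IsHolder T α Y := by
    refine isHolder_of_forward (C := C + M * C₂ + M * C₁) hδ (by positivity) hcomp
      (fun t ht => ⟨(hpos t ht).le, by linarith [(h0α t ht).2]⟩) hB ?_
    intro s t hs hst ht hd hd1
    have hsm : s ∈ Set.Icc 0 T := ⟨hs, by linarith⟩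
    have habs : |t - s| = t - s := abs_of_nonneg (by linarith)
    have k1 := hR s t hs hst ht hd hd1
    have k2 := hC₁ s hsm t ⟨by linarith, ht⟩ (by rwa [habs])
    have k3 := abs_rpow_anti (x := t - s) (by rwa [habs]) (hpos s hsm).le
      (le_min (by linarith [hpos s hsm]) (h0α s hsm).2.le : α s ≤ min (2 * α s) 1)
    rw [habs] at k2 k3
    have e : Y t - Y s = remainder X Y (fun t => f (Y t)) s t + f (Y s) (X t - X s) := by
      simp [remainder]
    rw [e, add_mul, mul_assoc M]
    refine (norm_add_le _ _).trans (add_le_add (k1.trans (by gcongr)) ?_)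
    exact (ContinuousLinearMap.le_opNorm _ _).trans
      (mul_le_mul (hf.fst.bound _) k2 (norm_nonneg _) hM)
  have hfY : IsHolder T α (fun t => f (Y t)) := by
    obtain ⟨K, hK⟩ := hYα
    refine ⟨M * K, fun s hs t ht hst => ?_⟩
    refine (hf.fst.lip _ _).trans ?_
    rw [mul_assoc]
    have := hK s hs t ht hst
    gcongr
  refine ⟨⟨hfY, ?_⟩, rfl, fun t _ => rfl, fun t ht => ?_⟩
  · refine isHolderTwo_remainder_of_forward (B := B + B + M * C₁) (C := C + M * C₂)
      hX.holder_fst hfY hδ (by positivity)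
      (hcomp.two_mul.min_one fun t ht => by linarith [hpos t ht])
      (fun t ht => ⟨le_min (by linarith [hpos t ht]) zero_le_one,
        (min_le_right _ _).trans (by norm_num)⟩) (fun t ht => min_le_left _ _) ?_ hR
    intro s hs t ht hst
    have k1 : ‖X t - X s‖ ≤ C₁ := (hC₁ s hs t ht hst).trans
      (mul_le_of_le_one_right h1 (Real.rpow_le_one (abs_nonneg _) hst (hpos s hs).le))
    refine (norm_sub_le _ _).trans (add_le_add
      ((norm_sub_le _ _).trans (add_le_add (hB t ht) (hB s hs))) ?_)
    exact (ContinuousLinearMap.le_opNorm _ _).trans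
      (mul_le_mul (hf.fst.bound _) k1 (norm_nonneg _) hM)
  · exact isRiemannLimit_of_increments hθ hC hδ hY ht

/-- If `𝕏` has order `2α`, then so has the remainder of a solution. -/
lemma IsRDESolution.isHolderTwo_remainder (hT : 0 < T) (hα : IsRegularityFunction T α)
    (h0α : ∀ t ∈ Set.Icc 0 T, α t ∈ Set.Ioo (1 / 3 : ℝ) 1)
    (hX : IsRoughPath T α X XX) (hf : FieldBound M f)
    {y : Vec n} {Y : ℝ → Vec n} {Y' : ℝ → LinVec d n} (h : IsRDESolution T α X XX f y Y Y')
    (hXX : IsHolderTwo T (fun s => 2 * α s) XX) :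
    IsHolderTwo T (fun s => 2 * α s) (remainder X Y Y') := by
  have hM := hf.nonneg
  have hpos : ∀ t ∈ Set.Icc 0 T, 0 < α t := fun t ht => by linarith [(h0α t ht).1]
  have hne : (Set.Icc 0 T).Nonempty := ⟨0, le_rfl, hT.le⟩
  obtain ⟨p, hp, hpmin⟩ := isCompact_Icc.exists_isMinOn hne hα.1
  obtain ⟨q, hq, hqmax⟩ := isCompact_Icc.exists_isMaxOn hne hα.1
  have hp3 := (h0α p hp).1
  have hq1 := (h0α q hq).2
  -- With `a = α(s) - η`, the bounds `η ≤ 1/9` and `η ≤ 1 - max α` give `min (2a) 1 + a ≥ 2α(s)`,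
  -- according to which term attains the minimum; `η < min α - 1/3` keeps all orders above `1/3`.
  obtain ⟨η, hη0, hη1, hη2, hη3⟩ : ∃ η : ℝ, 0 < η ∧ η ≤ 1 / 9 ∧ η < α p - 1 / 3 ∧ η ≤ 1 - α q :=
    ⟨min (1 / 9) (min ((α p - 1 / 3) / 2) (1 - α q)),
      lt_min (by norm_num) (lt_min (by linarith) (by linarith)), min_le_left _ _,
      ((min_le_right _ _).trans (min_le_left _ _)).trans_lt (by linarith),
      (min_le_right _ _).trans (min_le_right _ _)⟩
  obtain ⟨δ, hδ, hunif⟩ := Metric.uniformContinuousOn_iff.1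
    (isCompact_Icc.uniformContinuousOn_of_continuous hα.1) η hη0
  obtain ⟨C₁, h1, hC₁⟩ := IsHolderTwo.exists_nonneg hX.holder_fst
  obtain ⟨C₂, h2, hC₂⟩ := hXX.exists_nonneg
  obtain ⟨C₃, h3, hC₃⟩ := IsHolderTwo.exists_nonneg (h.isHolder h0α hX hf)
  obtain ⟨C₄, h4, hC₄⟩ := h.controlled.holder_remainder.exists_nonneg
  obtain ⟨B, hBdef⟩ : ∃ B, B = C₁ + C₂ + C₃ + C₄ := ⟨_, rfl⟩
  have hB : 0 ≤ B := by rw [hBdef]; positivity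
  have ha₀ : 1 / 3 < α p - η := by linarith
  obtain ⟨D, hD⟩ : ∃ D, D = (M * (B ^ 2 + B) * B + M * B * B) /
    (1 - (2 / 3 : ℝ) ^ (min (2 * (α p - η)) 1 + (α p - η) - 1)) := ⟨_, rfl⟩
  have hD0 : 0 ≤ D := by
    have := two_thirds_rpow_lt_one (one_lt_min_add ha₀)
    rw [hD]
    exact div_nonneg (by positivity) (by linarith)
  refine isHolderTwo_remainder_of_forward (δ := δ / 2) (B := C₄) (C := D + M * C₂)
    hX.holder_fst h.controlled.holder_deriv (by positivity) (by positivity)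
    (hα.isComparable hpos).two_mul
    (fun t ht => ⟨by linarith [hpos t ht], by linarith [(h0α t ht).2]⟩) (fun t _ => le_rfl)
    (fun s hs t ht hst => (hC₄ s hs t ht hst).trans (mul_le_of_le_one_right h4
      (Real.rpow_le_one (abs_nonneg _) hst (le_min (by linarith [hpos s hs]) zero_le_one)))) ?_
  intro s t hs hst ht hd hd1
  have hsm : s ∈ Set.Icc 0 T := ⟨hs, by linarith⟩
  have hps : α p ≤ α s := hpmin hsm
  have hsq : α s ≤ α q := hqmax hsm
  -- Uniform continuity makes `α(s) - η` a valid constant order on the whole interval `[s,t]`.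
  have hloc : ∀ u, s ≤ u → u ≤ t → u ∈ Set.Icc 0 T ∧ α s - η ≤ α u := by
    intro u hsu hut
    have hum : u ∈ Set.Icc 0 T := ⟨by linarith, by linarith⟩
    have := hunif u hum s hsm (by
      rw [Real.dist_eq, abs_of_nonneg (by linarith)]; linarith)
    rw [Real.dist_eq] at this
    exact ⟨hum, by linarith [(abs_lt.1 this).1]⟩
  have herr := norm_error_le hf hX.chen (fun t ht => h.isRiemannLimit ht) hs hst ht hd1 ha₀
    (a := α s - η) (B := B) (by linarith) hB
    (fun u v hu huv hv => forward_bound (g := fun u v => X v - X u) h1 (by linarith) hC₁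
      (by linarith) huv (by linarith) (by linarith) (by linarith) (hloc u hu (by linarith)).2)
    (fun u v hu huv hv => forward_bound h2 (by linarith) hC₂ (by linarith) huv (by linarith)
      (by linarith) (by linarith) (by linarith [(hloc u hu (by linarith)).2]))
    (fun u v hu huv hv => forward_bound (g := fun u v => Y v - Y u) h3 (by linarith) hC₃
      (by linarith) huv (by linarith) (by linarith) (by linarith) (hloc u hu (by linarith)).2)
    (fun u v hu huv hv => by
      obtain ⟨hum, hαu⟩ := hloc u hu (by linarith)
      have := forward_bound (b := min (2 * (α s - η)) 1) (B := B) h4 (by linarith) hC₄ hum.1 huv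
        (by linarith) (by linarith) (le_min (by linarith) zero_le_one)
        (min_le_min (by linarith) le_rfl)
      simpa [remainder, h.deriv_eq u hum] using this)
  rw [← hD] at herr
  have habs : |t - s| = t - s := abs_of_nonneg (by linarith)
  have k2 := hC₂ s hsm t ⟨by linarith, ht⟩ (by rwa [habs])
  have k3 := abs_rpow_anti (x := t - s) (p := 2 * α s) (q := min (2 * (α s - η)) 1 + (α s - η))
    (by rwa [habs]) (by linarith)
    (by rcases min_cases (2 * (α s - η)) 1 with hm | hm <;> linarith)
  rw [habs] at k2 k3
  have e : remainder X Y Y' s t =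
      (Y t - Y s - rdeIncr f X XX s t (Y s)) + secondField f (Y s) (XX s t) := by
    simp only [remainder, rdeIncr, incr, h.deriv_eq s hsm]; abel
  rw [e, add_mul, mul_assoc M]
  refine (norm_add_le _ _).trans (add_le_add (herr.trans (by gcongr)) ?_)
  exact (ContinuousLinearMap.le_opNorm _ _).trans
    (mul_le_mul (hf.snd.bound _) k2 (norm_nonneg _) hM)

end Order

end VariableOrder

end

/-! ### Existence, uniqueness and the sharper remainder. -/

theorem mainTheorem4 {d n : ℕ} (T : ℝ) (hT : 0 < T)
    (α : ℝ → ℝ) (hα : VariableOrder.IsRegularityFunction T α)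
    (hα_range : ∀ t ∈ Set.Icc 0 T, α t ∈ Set.Ioo (1 / 3 : ℝ) 1)
    (X : ℝ → VariableOrder.Vec d) (XX : ℝ → ℝ → VariableOrder.SqMat d)
    (hX : VariableOrder.IsRoughPath T α X XX)
    (f : VariableOrder.Vec n → VariableOrder.LinVec d n) (hf : VariableOrder.IsCb 3 f)
    (y : VariableOrder.Vec n) :
    ∃ (Y : ℝ → VariableOrder.Vec n) (Y' : ℝ → VariableOrder.LinVec d n),
      VariableOrder.IsRDESolution T α X XX f y Y Y' ∧
      (∀ (Z : ℝ → VariableOrder.Vec n) (Z' : ℝ → VariableOrder.LinVec d n),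
        VariableOrder.IsRDESolution T α X XX f y Z Z' →
          Set.EqOn Z Y (Set.Icc 0 T) ∧ Set.EqOn Z' Y' (Set.Icc 0 T)) ∧
      (VariableOrder.IsHolderTwo T (fun s => 2 * α s) XX →
        VariableOrder.IsHolderTwo T (fun s => 2 * α s) (VariableOrder.remainder X Y Y')) := by
  obtain ⟨M, hM, hfM⟩ := hf.exists_fieldBound
  obtain ⟨p, hp, hpmin⟩ := isCompact_Icc.exists_isMinOn ⟨0, le_rfl, hT.le⟩ hα.1
  have hp3 := (hα_range p hp).1
  -- The cap `1/2` ensures `2a ≤ 2α ∧ 1`, so that `𝕏` has constant order `2a`; the minimum of `α`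
  -- over the compact interval keeps `a > 1/3`.
  obtain ⟨a, ha⟩ : ∃ a, a = min (α p) (1 / 2) := ⟨_, rfl⟩
  have ha3 : 1 / 3 < a := ha ▸ lt_min hp3 (by norm_num)
  have ha2 : a ≤ 1 / 2 := ha ▸ min_le_right _ _
  have haα : ∀ t ∈ Set.Icc 0 T, a ≤ α t := fun t ht =>
    (ha ▸ min_le_left _ _ : a ≤ α p).trans (hpmin ht)
  obtain ⟨K, hK⟩ := hX.exists_roughBound (by linarith) haα ha2
  obtain ⟨δ, L, H⟩ := hK.exists_almostFlow ha3 hfM hM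
  obtain ⟨Y, hY0, C, δ', hC, hδ', hδδ, hY⟩ := H.exists_follows
    (fun U σ ρ z s t y hst ht hev hσ hρ hz =>
      hK.tendsto_rdeIncr (by linarith) hfM hst.le ht hev hσ hρ hz) y
  have H' := H.mono hδ' hδδ
  obtain ⟨B, hB⟩ := hY.exists_bound H' hC
  have hsol := hY.isRDESolution hα hα_range hX hfM hδ' H.one_lt hC hB
  rw [hY0] at hsol
  refine ⟨Y, fun t => f (Y t), hsol, fun Z Z' hZ => ?_,
    hsol.isHolderTwo_remainder hT hα hα_range hX hfM⟩
  obtain ⟨C', hC', hZf⟩ := hZ.exists_follows hα_range hX hfM ha3 haα ha2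
  -- The two paths follow the almost flow with different constants and at different scales; the
  -- larger constant and the smaller scale serve both.
  have heq := H'.unique (le_max_of_le_left hC)
    (hZf.mono (hδδ.trans H.δ_le) (le_max_right C C')) (hY.mono le_rfl (le_max_left C C'))
    (by rw [hZ.initial, hY0])
  exact ⟨heq, fun t ht => by rw [hZ.deriv_eq t ht, heq ht]⟩
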